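/- Let $0\le d\le n$ be integers, let $E=\{1,\dots,n\}$, and let $\mathsf U_{d,n}$ be the uniform matroid of rank $d$ on $E$, whose independent sets are the subsets of $E$ with at most $d$ elements. For a matroid $\mathsf M$ on $E$, a proper flat is a flat different from $E$. The augmented Bergman complex $\Delta_{\mathsf M}$ is the simplicial complex on the vertices $u_i$ ($i\in E$) and $v_F$ ($F$ a proper flat of $\mathsf M$) whose faces are the sets $\{u_i : i\in S\}\cup\{v_{F_1},\dots,v_{F_k}\}$ with $k\ge 0$, where $S$ is an independent set of $\mathsf M$, $F_1\subsetneq\cdots\subsetneq F_k$ are proper flats and, if $k\ge 1$, $S\subseteq F_1$. The $h$-polynomial of a $(d-1)$-dimensional simplicial complex $\Delta$ is $h(\Delta,x)=\sum_{\sigma\in\Delta}x^{|\sigma|}(1-x)^{d-|\sigma|}$, where the sum includes the empty face. The augmented Chow ring of $\mathsf M$ is the graded $\mathbb Q$-algebra $$\mathrm{CH}(\mathsf M)=\mathbb Q[\,y_i,\ x_F : i\in E,\ F \text{ a proper flat}\,]/(I+J),$$ with all variables in degree $1$, where $I$ is generated by the elements $y_i-\sum_{F\not\ni i}x_F$ for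 $i\in E$ (the sum is over proper flats), and $J$ by the products $x_Fx_G$ for incomparable proper flats $F,G$ and the products $y_ix_F$ for $i\notin F$. Let $\mathrm H_{\mathsf M}(x)=\sum_{k\ge 0}\dim_{\mathbb Q}\mathrm{CH}^k(\mathsf M)\,x^k$ be its Hilbert–Poincaré series. Then $$x^{d}\,h(\Delta_{\mathsf U_{d,n}},x^{-1})=\sum_{i=0}^{d}\binom{n-i-1}{d-i}\,\mathrm H_{\mathsf U_{i,n}}(x),$$ where $\binom{-1}{0}=1$ (this occurs only for $i=d=n$). -/

import Mathlib

/-- A finite abstract simplicial complex on a vertex set `V`: a downward closed family of finite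
subsets of `V` which contains the empty face (not every element of `V` has to be a face). -/
structure FinSimplicialComplex (V : Type*) where
  faces : Finset (Finset V)
  empty_mem : ∅ ∈ faces
  down_closed : ∀ σ ∈ faces, ∀ τ : Finset V, τ ⊆ σ → τ ∈ faces

/-- The largest cardinality of a face, that is, the number `d` such that the complex is
`(d - 1)`-dimensional. -/
def FinSimplicialComplex.maxCard {V : Type*} (Δ : FinSimplicialComplex V) : ℕ :=
  Δ.faces.sup Finset.card

/-- The `h`-polynomial `∑_{σ ∈ Δ} x^|σ| (1 - x)^(d - |σ|)` of a `(d - 1)`-dimensional complex. -/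
noncomputable def FinSimplicialComplex.hPolynomial {V : Type*} (Δ : FinSimplicialComplex V) :
    Polynomial ℤ :=
  ∑ σ ∈ Δ.faces, Polynomial.X ^ σ.card * (1 - Polynomial.X) ^ (Δ.maxCard - σ.card)

namespace Matroid

/-- The proper flats of a matroid: all flats except the ground set. -/
abbrev ProperFlat {α : Type*} (M : Matroid α) : Type _ :=
  {F : Set α // M.IsFlat F ∧ F ≠ M.E}

/-- `Sum.inl i` stands for the vertex `u_i` of the augmented Bergman complex (the variable `y_i` of
the augmented Chow ring), for `i` in the ground set; `Sum.inr F` stands for the vertex `v_F` (the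
variable `x_F`), for `F` a proper flat. -/
abbrev AugVertex {α : Type*} (M : Matroid α) : Type _ :=
  M.E ⊕ M.ProperFlat

/-- The set `{u_i : i ∈ S} ∪ {v_{F_1}, …, v_{F_k}}` is a face of the augmented Bergman complex if
and only if `S` is independent, the flats `F_1, …, F_k` form a chain, and each of them
contains `S`. -/
def IsAugFace {α : Type*} (M : Matroid α) (σ : Finset M.AugVertex) : Prop :=
  M.Indep {a : α | ∃ i : M.E, (i : α) = a ∧ Sum.inl i ∈ σ} ∧
  (∀ F G : M.ProperFlat, Sum.inr F ∈ σ → Sum.inr G ∈ σ → F.1 ⊆ G.1 ∨ G.1 ⊆ F.1) ∧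
  (∀ (i : M.E) (F : M.ProperFlat), Sum.inl i ∈ σ → Sum.inr F ∈ σ → (i : α) ∈ F.1)

/-- The augmented Bergman complex of a matroid. -/
noncomputable def augmentedBergmanComplex {α : Type*} [Finite α] (M : Matroid α) :
    FinSimplicialComplex M.AugVertex where
  faces := (Set.toFinite {σ : Finset M.AugVertex | M.IsAugFace σ}).toFinset
  empty_mem := by simp [IsAugFace]
  down_closed := by
    intro σ hσ τ hτ
    simp only [Set.Finite.mem_toFinset, Set.mem_ofPred_eq] at hσ ⊢
    obtain ⟨h1, h2, h3⟩ := hσ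
    refine ⟨h1.subset ?_, fun F G hF hG => h2 F G (hτ hF) (hτ hG),
      fun i F hi hF => h3 i F (hτ hi) (hτ hF)⟩
    rintro a ⟨i, hi, hiτ⟩
    exact ⟨i, hi, hτ hiτ⟩

/-- The ideal of relations of the augmented Chow ring, generated by
`y_i - ∑_{F ∌ i} x_F` for `i` in the ground set, by `x_F x_G` for incomparable proper flats
`F`, `G`, and by `y_i x_F` for `i ∉ F`. -/
noncomputable def augmentedChowIdeal {α : Type*} [Finite α] (M : Matroid α) :
    Ideal (MvPolynomial M.AugVertex ℚ) :=
  Ideal.span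
    ({p | ∃ i : M.E, p = MvPolynomial.X (Sum.inl i) -
        ∑ F ∈ (Set.toFinite {F : M.ProperFlat | (i : α) ∉ F.1}).toFinset,
          MvPolynomial.X (Sum.inr F)} ∪
      {p | ∃ F G : M.ProperFlat, ¬ F.1 ⊆ G.1 ∧ ¬ G.1 ⊆ F.1 ∧
        p = MvPolynomial.X (Sum.inr F) * MvPolynomial.X (Sum.inr G)} ∪
      {p | ∃ (i : M.E) (F : M.ProperFlat), (i : α) ∉ F.1 ∧
        p = MvPolynomial.X (Sum.inl i) * MvPolynomial.X (Sum.inr F)})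

/-- The augmented Chow ring of a matroid, with rational coefficients. -/
abbrev AugmentedChowRing {α : Type*} [Finite α] (M : Matroid α) : Type _ :=
  MvPolynomial M.AugVertex ℚ ⧸ M.augmentedChowIdeal

/-- The degree `k` piece of the augmented Chow ring: the classes of the homogeneous polynomials
of degree `k` (all variables have degree one, and the relations are homogeneous). -/
noncomputable def augmentedChowPiece {α : Type*} [Finite α] (M : Matroid α) (k : ℕ) :
    Submodule ℚ M.AugmentedChowRing :=
  (MvPolynomial.homogeneousSubmodule M.AugVertex ℚ k).map
    (Ideal.Quotient.mkₐ ℚ M.augmentedChowIdeal).toLinearMap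

/-- The Hilbert–Poincaré series of the augmented Chow ring. -/
noncomputable def augmentedChowSeries {α : Type*} [Finite α] (M : Matroid α) : PowerSeries ℤ :=
  PowerSeries.mk fun k => (Module.finrank ℚ (M.augmentedChowPiece k) : ℤ)

/-- The uniform matroid on the ground set `Fin n`, whose independent sets are the sets with at
most `d` elements; it has rank `d` if `d ≤ n`. -/
def uniformMatroid (d n : ℕ) : Matroid (Fin n) :=
  (IndepMatroid.ofFinite (E := Set.univ) Set.finite_univ (fun I => I.ncard ≤ d)
    (by simp)
    (fun I J hJ hIJ => (Set.ncard_le_ncard hIJ (Set.toFinite J)).trans hJ)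
    (fun I J hI hJ hIJ => by
      obtain ⟨e, heJ, heI⟩ := Set.exists_mem_notMem_of_ncard_lt_ncard hIJ (Set.toFinite I)
      refine ⟨e, heJ, heI, ?_⟩
      rw [Set.ncard_insert_of_notMem heI (Set.toFinite I)]
      exact (Nat.succ_le_of_lt hIJ).trans hJ)
    (fun I _ => Set.subset_univ I)).matroid

end Matroid

/-! Both sides are made explicit and shown to satisfy the same recursion in the rank.

Chow side. Put h_A = ∑_{F ⊉ A} x_F (`coneSum`), so that y_i = h_{i} and Moebius inversion recovers
x_F. The defining relations give (h_F - h_{F∪G})(h_G - h_{F∪G}) = 0, h_G^(min(|G|,d)+1) = 0 and, for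
F ⊂ G with |F| < d, h_F h_G^m = h_G^(m+1) with m = min(|G|,d) - |F|; moreover h_A = h_E as soon as
|A| ≥ d. Used as rewriting rules they express every monomial in the h_A through standard ones,
supported on chains with multiplicities bounded by the gaps (`prod_mem_span_isStandard`).

For independence, let a functional take the value 1 on h_{A_1}⋯h_{A_d} if the A_j satisfy Hall's
condition, and 0 on all other monomials. Its annihilator ideal contains all relations of the Chow
ring (`augmentedChowIdeal_le_comap`), so it suffices to work modulo that ideal. There each standard
monomial is paired with a product of elements x_G along a chain and some h_A; the resulting matrix
is triangular (`DualChain.dominates`) with diagonal 1 (`DualChain.hallForm_eq_one`). Hence the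
Hilbert series counts standard multisets by size (`augmentedChowSeries_uniformMatroid`).

Enumeration. Let N_m count nested multisets with a fixed largest member of size m. Then H_{d,n} =
x^d + ∑_{m<d} C(n,m)(1 + ⋯ + x^(d-m-1)) N_m, whence H_{d+1,n} = x H_{d,n} + ∑_{m≤d} C(n,m) N_m and
H_{d,d} = ∑_{m≤d} C(d,m) N_m. With Pascal's rule and a hockey-stick sum, the right-hand side B_{d,n}
of the theorem satisfies B_{d+1,n} = (x-1) B_{d,n} + C(n,d+1) + C(n,d) H_{d,d} for d < n
(`chowTransform_succ`).

Bergman side. Here x^d h(1/x) = ∑_σ (x-1)^(d-|σ|). The faces whose largest flat is G are, after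
removal of G, the faces of the complex of the Boolean matroid on G (`sum_flagFaces_nonempty`). Since
B_{m,m} = H_{m,m}, induction on the rank matches this with the unrolled recursion for B
(`flagPoly_eq_chowTransform`). -/

open Finset

set_option linter.unusedSectionVars false

/-! ### Hall's condition for multisets of sets and its exchange properties -/

section Hall

variable {α : Type*} [DecidableEq α]

/-- Hall's marriage condition for a multiset of finite sets. -/
def HallCondition (s : Multiset (Finset α)) : Prop :=
  ∀ t ≤ s, t.card ≤ t.sup.card

theorem HallCondition.of_le {s t : Multiset (Finset α)} (hs : HallCondition s) (h : t ≤ s) :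
    HallCondition t := fun u hu => hs u (hu.trans h)

theorem hallCondition_cons_iff {s : Multiset (Finset α)} {A : Finset α} :
    HallCondition (A ::ₘ s) ↔
      HallCondition s ∧ ∀ t ≤ s, t.card + 1 ≤ (A ∪ t.sup).card := by
  constructor
  · intro h
    refine ⟨h.of_le (Multiset.le_cons_self _ _), fun t ht => ?_⟩
    simpa using h (A ::ₘ t) (Multiset.cons_le_cons A ht)
  · rintro ⟨h1, h2⟩ t ht
    by_cases hA : A ∈ t
    · obtain ⟨u, rfl⟩ := Multiset.exists_cons_of_mem hA
      simpa using h2 u ((Multiset.cons_le_cons_iff A).1 ht)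
    · exact h1 t ((Multiset.le_cons_of_notMem hA).1 ht)

theorem HallCondition.cons_mono {s : Multiset (Finset α)} {A B : Finset α}
    (h : HallCondition (A ::ₘ s)) (hAB : A ⊆ B) : HallCondition (B ::ₘ s) := by
  rw [hallCondition_cons_iff] at h ⊢
  exact ⟨h.1, fun t ht => (h.2 t ht).trans (card_le_card (union_subset_union_left hAB))⟩

/-- Separates what depends on `A` alone, on `B` alone, and on both. The joint part sees only `A ∪
B`, which is what makes exchange arguments possible. -/
theorem hallCondition_cons_cons_iff {s : Multiset (Finset α)} {A B : Finset α} :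
    HallCondition (A ::ₘ B ::ₘ s) ↔
      HallCondition (A ::ₘ s) ∧ HallCondition (B ::ₘ s) ∧
        ∀ t ≤ s, t.card + 2 ≤ ((A ∪ B) ∪ t.sup).card := by
  constructor
  · intro h
    refine ⟨h.of_le (Multiset.cons_le_cons A (Multiset.le_cons_self _ _)),
      h.of_le (Multiset.le_cons_self _ _), fun t ht => ?_⟩
    have := h (A ::ₘ B ::ₘ t) (Multiset.cons_le_cons A (Multiset.cons_le_cons B ht))
    simp only [Multiset.card_cons, Multiset.sup_cons] at this
    rw [union_assoc]
    exact this
  · rintro ⟨hA, hB, h2⟩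
    rw [hallCondition_cons_iff]
    refine ⟨hB, fun t ht => ?_⟩
    by_cases hBt : B ∈ t
    · obtain ⟨u, rfl⟩ := Multiset.exists_cons_of_mem hBt
      have := h2 u ((Multiset.cons_le_cons_iff B).1 ht)
      rw [union_assoc] at this
      rw [Multiset.card_cons, Multiset.sup_cons]
      exact this
    · exact (hallCondition_cons_iff.1 hA).2 t ((Multiset.le_cons_of_notMem hBt).1 ht)

theorem exists_tight_of_not_hallCondition_cons {s : Multiset (Finset α)} {A : Finset α}
    (hs : HallCondition s) (hA : ¬ HallCondition (A ::ₘ s)) :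
    ∃ t ≤ s, (A ∪ t.sup).card ≤ t.card := by
  rw [hallCondition_cons_iff] at hA
  push Not at hA
  obtain ⟨t, ht, h⟩ := hA hs
  exact ⟨t, ht, by omega⟩

/-- Tight sub-multisets are closed under union. -/
theorem exists_tight_union {s : Multiset (Finset α)} {A B : Finset α}
    (hs : HallCondition s) (hA : ¬ HallCondition (A ::ₘ s)) (hB : ¬ HallCondition (B ::ₘ s)) :
    ∃ t ≤ s, ((A ∪ B) ∪ t.sup).card ≤ t.card := by
  obtain ⟨t, ht, hAt⟩ := exists_tight_of_not_hallCondition_cons hs hA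
  obtain ⟨u, hu, hBu⟩ := exists_tight_of_not_hallCondition_cons hs hB
  refine ⟨t ∪ u, Multiset.union_le ht hu, ?_⟩
  -- Submodularity: Hall's condition for `t ∩ u` bounds the intersection from below, so the union
  -- has to be tight.
  have h1 := card_union_add_card_inter (A ∪ t.sup) (B ∪ u.sup)
  have h2 := hs (t ∩ u) ((Multiset.inter_le_left).trans ht)
  have h3 : (t ∩ u).sup ⊆ (A ∪ t.sup) ∩ (B ∪ u.sup) := by
    refine subset_inter ?_ ?_
    · exact (Multiset.sup_mono (Multiset.subset_of_le Multiset.inter_le_left)).trans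
        subset_union_right
    · exact (Multiset.sup_mono (Multiset.subset_of_le Multiset.inter_le_right)).trans
        subset_union_right
  have h4 := card_le_card h3
  have h5 : t.card + u.card = (t ∪ u).card + (t ∩ u).card := by
    rw [← Multiset.card_add, ← Multiset.card_add, Multiset.union_add_inter]
  have h6 : (A ∪ B) ∪ (t ∪ u).sup = (A ∪ t.sup) ∪ (B ∪ u.sup) := by
    have : (t ∪ u).sup = t.sup ∪ u.sup := Multiset.sup_union t u
    rw [this]; ext x; simp only [mem_union]; tauto
  rw [h6]; omega

theorem not_hallCondition_cons_of_tight {s t : Multiset (Finset α)} {A : Finset α}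
    (ht : t ≤ s) (h : (A ∪ t.sup).card ≤ t.card) : ¬ HallCondition (A ::ₘ s) := by
  rw [hallCondition_cons_iff]
  rintro ⟨-, h2⟩
  have := h2 t ht
  omega

theorem not_hallCondition_union_cons {s : Multiset (Finset α)} {A B : Finset α}
    (hA : ¬ HallCondition (A ::ₘ s)) (hB : ¬ HallCondition (B ::ₘ s)) :
    ¬ HallCondition ((A ∪ B) ::ₘ s) := by
  intro h
  obtain ⟨t, ht, h'⟩ := exists_tight_union (h.of_le (Multiset.le_cons_self _ _)) hA hB
  exact not_hallCondition_cons_of_tight ht h' h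

theorem not_hallCondition_empty_cons (s : Multiset (Finset α)) :
    ¬ HallCondition (∅ ::ₘ s) :=
  not_hallCondition_cons_of_tight (Multiset.zero_le s) (by simp)

open Classical in
/-- The indicator of Hall's condition for multisets of cardinality `d`. -/
noncomputable def hallIndicator (d : ℕ) (s : Multiset (Finset α)) : ℚ :=
  if s.card = d ∧ HallCondition s then 1 else 0

theorem hallIndicator_congr {d : ℕ} {s t : Multiset (Finset α)} (hc : s.card = t.card)
    (h : HallCondition s ↔ HallCondition t) : hallIndicator d s = hallIndicator d t := by
  by_cases hs : HallCondition s
  · simp [hallIndicator, hc, hs, h.1 hs]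
  · simp [hallIndicator, hs, mt h.2 hs]

theorem hallIndicator_eq_zero {d : ℕ} {s : Multiset (Finset α)} (h : ¬ HallCondition s) :
    hallIndicator d s = 0 := by
  simp [hallIndicator, h]

/-- All four pairs have the same union, so the joint condition is common to them. If `A` or `B`
passes Hall's condition alone, enlarging it changes nothing and the terms cancel in pairs. If both
fail, tight multisets for them combine to one for `A ∪ B`, and all four terms vanish. -/
theorem hallIndicator_exchange (d : ℕ) (s : Multiset (Finset α)) {A A' B B' : Finset α}
    (hA : A ⊆ A') (hA' : A' ⊆ A ∪ B) (hB : B ⊆ B') (hB' : B' ⊆ A ∪ B) :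
    hallIndicator d (A ::ₘ B ::ₘ s) - hallIndicator d (A' ::ₘ B ::ₘ s) -
      hallIndicator d (A ::ₘ B' ::ₘ s) + hallIndicator d (A' ::ₘ B' ::ₘ s) = 0 := by
  have e1 : A' ∪ B = A ∪ B :=
    subset_antisymm (union_subset hA' subset_union_right) (union_subset_union_left hA)
  have e2 : A ∪ B' = A ∪ B :=
    subset_antisymm (union_subset subset_union_left hB') (union_subset_union_right hB)
  have e3 : A' ∪ B' = A ∪ B :=
    subset_antisymm (union_subset hA' hB') (union_subset_union hA hB)
  by_cases h1 : HallCondition (A ::ₘ s)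
  · have h1' := h1.cons_mono hA
    have k1 : hallIndicator d (A ::ₘ B ::ₘ s) = hallIndicator d (A' ::ₘ B ::ₘ s) :=
      hallIndicator_congr (by simp) (by
        rw [hallCondition_cons_cons_iff, hallCondition_cons_cons_iff, e1]; tauto)
    have k2 : hallIndicator d (A ::ₘ B' ::ₘ s) = hallIndicator d (A' ::ₘ B' ::ₘ s) :=
      hallIndicator_congr (by simp) (by
        rw [hallCondition_cons_cons_iff, hallCondition_cons_cons_iff, e2, e3]; tauto)
    rw [k1, k2]; ring
  by_cases h2 : HallCondition (B ::ₘ s)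
  · have h2' := h2.cons_mono hB
    have k1 : hallIndicator d (A ::ₘ B ::ₘ s) = hallIndicator d (A ::ₘ B' ::ₘ s) :=
      hallIndicator_congr (by simp) (by
        rw [hallCondition_cons_cons_iff, hallCondition_cons_cons_iff, e2]; tauto)
    have k2 : hallIndicator d (A' ::ₘ B ::ₘ s) = hallIndicator d (A' ::ₘ B' ::ₘ s) :=
      hallIndicator_congr (by simp) (by
        rw [hallCondition_cons_cons_iff, hallCondition_cons_cons_iff, e1, e3]; tauto)
    rw [k1, k2]; ring
  have key : ¬ (HallCondition s ∧ ∀ t ≤ s, t.card + 2 ≤ ((A ∪ B) ∪ t.sup).card) := by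
    rintro ⟨hs, h⟩
    obtain ⟨t, ht, h'⟩ := exists_tight_union hs h1 h2
    have := h t ht
    omega
  have hs : ∀ C, HallCondition (C ::ₘ s) → HallCondition s :=
    fun C h => h.of_le (Multiset.le_cons_self _ _)
  rw [hallIndicator_eq_zero, hallIndicator_eq_zero, hallIndicator_eq_zero, hallIndicator_eq_zero]
  · simp
  all_goals
    rw [hallCondition_cons_cons_iff]
    try simp only [e1, e2, e3]
    intro h
    exact key ⟨hs _ h.1, h.2.2⟩

/-- A tight multiset for `A` grows by at most one element when `i` is added, whereas the joint
condition, which is the same on both sides, asks for two more elements than members. -/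
theorem hallIndicator_singleton_insert (d : ℕ) (s : Multiset (Finset α)) (i : α) (A : Finset α) :
    hallIndicator d ({i} ::ₘ A ::ₘ s) = hallIndicator d ({i} ::ₘ insert i A ::ₘ s) := by
  refine hallIndicator_congr (by simp) ?_
  have e1 : {i} ∪ insert i A = {i} ∪ A := by ext; simp
  rw [hallCondition_cons_cons_iff, hallCondition_cons_cons_iff, e1]
  constructor
  · rintro ⟨h1, h2, h3⟩
    exact ⟨h1, h2.cons_mono (subset_insert _ _), h3⟩
  · rintro ⟨h1, h2, h3⟩
    refine ⟨h1, ?_, h3⟩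
    by_contra h
    obtain ⟨t, ht, h'⟩ :=
      exists_tight_of_not_hallCondition_cons (h1.of_le (Multiset.le_cons_self _ _)) h
    have h4 := h3 t ht
    rw [union_assoc] at h4
    have h5 := card_union_le {i} (A ∪ t.sup)
    rw [card_singleton] at h5
    omega

theorem hallIndicator_large [Fintype α] (d : ℕ) (s : Multiset (Finset α)) {A : Finset α}
    (hA : d ≤ A.card) : hallIndicator d (A ::ₘ s) = hallIndicator d (univ ::ₘ s) := by
  by_cases hc : s.card + 1 = d
  · refine hallIndicator_congr (by simp) ⟨fun h => h.cons_mono (subset_univ _), fun h => ?_⟩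
    refine hallCondition_cons_iff.2 ⟨h.of_le (Multiset.le_cons_self _ _), fun t ht => ?_⟩
    have h1 := Multiset.card_le_card ht
    have h2 := card_le_card (subset_union_left : A ⊆ A ∪ t.sup)
    omega
  · simp [hallIndicator, hc]

/-- A signed sum over an interval of finite sets vanishes if the summand does not depend on
whether some element belongs to the set. -/
theorem sum_Icc_neg_one_pow_eq_zero {M : Type*} [AddCommGroup M] {G T : Finset α} {i : α}
    (hi : i ∈ T) (hiG : i ∉ G) (f : Finset α → M)
    (hf : ∀ B, G ⊆ B → B ⊆ T → i ∉ B → f (insert i B) = f B) :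
    ∑ B ∈ Icc G T, (-1 : ℤ) ^ (B \ G).card • f B = 0 := by
  refine Finset.sum_involution (fun B _ => if i ∈ B then B.erase i else insert i B) ?_ ?_ ?_ ?_
  · intro B hB
    rw [mem_Icc] at hB
    split_ifs with h
    · have h1 := hf (B.erase i) (fun x hx => mem_erase.2 ⟨fun e => hiG (e ▸ hx), hB.1 hx⟩)
        ((erase_subset _ _).trans hB.2) (notMem_erase _ _)
      rw [insert_erase h] at h1
      have h2 : B \ G = insert i (B.erase i \ G) := by
        ext x; by_cases hx : x = i <;> simp [hx, h, hiG]
      rw [h1, h2, card_insert_of_notMem (by simp)]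
      rw [pow_succ]; simp
    · have h1 := hf B hB.1 hB.2 h
      have h2 : insert i B \ G = insert i (B \ G) := by
        ext x; by_cases hx : x = i <;> simp [hx, hiG]
      rw [h1, h2, card_insert_of_notMem (by simp [h])]
      rw [pow_succ]; simp
  · intro B hB _
    split_ifs with h
    · intro e; rw [← e] at h; simp at h
    · intro e; rw [← e] at h; simp at h
  · intro B hB
    rw [mem_Icc] at hB ⊢
    split_ifs with h
    · exact ⟨fun x hx => mem_erase.2 ⟨fun e => hiG (e ▸ hx), hB.1 hx⟩,
        (erase_subset _ _).trans hB.2⟩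
    · exact ⟨hB.1.trans (subset_insert _ _), insert_subset hi hB.2⟩
  · intro B hB
    by_cases h : i ∈ B <;> simp [h]

theorem sum_Icc_neg_one_pow_const_eq_zero {M : Type*} [AddCommGroup M] {G T : Finset α}
    (h : G ⊂ T) (m : M) : ∑ B ∈ Icc G T, (-1 : ℤ) ^ (B \ G).card • m = 0 := by
  obtain ⟨i, hi, hiG⟩ := exists_of_ssubset h
  exact sum_Icc_neg_one_pow_eq_zero hi hiG _ (fun _ _ _ _ => rfl)

open Classical in
-- When `s` satisfies Hall's condition, the sets that violate it together with `s` form an order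
-- ideal closed under unions. If `G` violates it and so does `insert i G`, toggling `i` is a
-- sign-reversing involution. A non-zero sum thus needs `G` to be the only violating set in the
-- interval, and only the missing term at `G` remains.
theorem sum_hallIndicator_cons {D : ℕ} {G T : Finset α} (hGT : G ⊂ T)
    {s : Multiset (Finset α)} (hs : s.card + 1 = D) :
    ∑ B ∈ Icc G T, (-1 : ℤ) ^ (B \ G).card • hallIndicator D (B ::ₘ s) =
      if HallCondition s ∧ ¬ HallCondition (G ::ₘ s) ∧
        ∀ i ∈ T, i ∉ G → HallCondition (insert i G ::ₘ s) then -1 else 0 := by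
  have hH : ∀ B, hallIndicator D (B ::ₘ s) = if HallCondition (B ::ₘ s) then 1 else 0 := by
    intro B; simp [hallIndicator, hs]
  by_cases h0 : HallCondition s
  swap
  · rw [if_neg (by tauto)]
    refine sum_eq_zero fun B _ => ?_
    rw [hallIndicator_eq_zero fun h => h0 (h.of_le (Multiset.le_cons_self _ _)), smul_zero]
  by_cases h1 : HallCondition (G ::ₘ s)
  · rw [if_neg (by tauto)]
    rw [← sum_Icc_neg_one_pow_const_eq_zero hGT (1 : ℚ)]
    refine sum_congr rfl fun B hB => ?_
    rw [hH, if_pos (h1.cons_mono (mem_Icc.1 hB).1)]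
  by_cases h2 : ∀ i ∈ T, i ∉ G → HallCondition (insert i G ::ₘ s)
  · rw [if_pos ⟨h0, h1, h2⟩]
    have h3 := sum_Icc_neg_one_pow_const_eq_zero hGT (1 : ℚ)
    have hG : G ∈ Icc G T := left_mem_Icc.2 hGT.1
    rw [← add_sum_erase _ _ hG] at h3 ⊢
    rw [hH, if_neg h1, smul_zero, zero_add]
    rw [sdiff_self, Finset.bot_eq_empty, Finset.card_empty, pow_zero, one_smul] at h3
    refine Eq.trans ?_ (neg_eq_of_add_eq_zero_right h3).symm
    refine sum_congr rfl fun B hB => ?_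
    rw [mem_erase, mem_Icc] at hB
    obtain ⟨i, hi, hiG⟩ := exists_of_ssubset (lt_of_le_of_ne hB.2.1 hB.1.symm)
    rw [hH, if_pos ((h2 i (hB.2.2 hi) hiG).cons_mono (insert_subset hi hB.2.1))]
  · rw [if_neg (by tauto)]
    push Not at h2
    obtain ⟨i, hi, hiG, h3⟩ := h2
    refine sum_Icc_neg_one_pow_eq_zero hi hiG _ fun B hGB _ _ => ?_
    refine hallIndicator_congr (by simp) ⟨fun h => ?_, fun h => h.cons_mono (subset_insert _ _)⟩
    by_contra h4
    refine not_hallCondition_union_cons h4 h3 ?_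
    rwa [show B ∪ insert i G = insert i B from by
      rw [union_insert, union_eq_left.2 hGB]]

/-- If a signed sum of Hall indicators does not vanish, then `s` has at least `|G|` members
inside `G`. -/
theorem card_le_card_filter_of_sum_hallIndicator_ne_zero {D : ℕ} {G T : Finset α} (hGT : G ⊂ T)
    {s : Multiset (Finset α)} (hsT : ∀ A ∈ s, A ⊆ T)
    (h : ∑ B ∈ Icc G T, (-1 : ℤ) ^ (B \ G).card • hallIndicator D (B ::ₘ s) ≠ 0) :
    G.card ≤ (s.filter (· ⊆ G)).card := by
  classical
  by_cases hs : s.card + 1 = D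
  swap
  · refine absurd (sum_eq_zero fun B _ => ?_) h
    simp [hallIndicator, hs]
  rw [sum_hallIndicator_cons hGT hs] at h
  obtain ⟨h0, h1, h2⟩ := of_not_not fun h' => h (if_neg h')
  obtain ⟨t, ht, htc⟩ := exists_tight_of_not_hallCondition_cons h0 h1
  -- An element `i` outside `G` of a member of `t` would make `t` tight for `insert i G` as well.
  have hsub : ∀ A ∈ t, A ⊆ G := by
    intro A hA i hi
    by_contra hiG
    refine not_hallCondition_cons_of_tight (A := insert i G) ht ?_
      (h2 i (hsT A (Multiset.mem_of_le ht hA) hi) hiG)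
    rwa [insert_union, insert_eq_of_mem]
    exact mem_union_right _ (Multiset.le_sup hA hi)
  calc G.card ≤ (G ∪ t.sup).card := card_le_card subset_union_left
    _ ≤ t.card := htc
    _ ≤ _ := Multiset.card_le_card (Multiset.le_filter.2 ⟨ht, hsub⟩)

end Hall

/-! ### Alternating sums over intervals of sets -/

section Moebius

variable {α : Type*} [DecidableEq α]

/-- The alternating sum `-∑_{G ⊆ B ⊆ T} (-1)^|B \ G| h(B)`. -/
def moebiusSum {M : Type*} [AddCommGroup M] (h : Finset α → M) (T G : Finset α) : M :=
  -∑ B ∈ Icc G T, (-1 : ℤ) ^ (B \ G).card • h B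

theorem map_moebiusSum {M N F : Type*} [AddCommGroup M] [AddCommGroup N] [FunLike F M N]
    [AddMonoidHomClass F M N] (f : F) (h : Finset α → M) (T G : Finset α) :
    f (moebiusSum h T G) = moebiusSum (fun B => f (h B)) T G := by
  simp only [moebiusSum, map_neg, map_sum, map_zsmul]

theorem moebiusSum_mul {C : Type*} [CommRing C] (h : Finset α → C) (T G : Finset α) (r : C) :
    moebiusSum h T G * r = moebiusSum (fun B => h B * r) T G := by
  simp only [moebiusSum, neg_mul, sum_mul, smul_mul_assoc]

theorem mul_moebiusSum {C : Type*} [CommRing C] (h : Finset α → C) (T G : Finset α) (r : C) :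
    r * moebiusSum h T G = moebiusSum (fun B => r * h B) T G := by
  simp only [moebiusSum, mul_neg, mul_sum, mul_smul_comm]

theorem moebiusSum_eq_zero {M : Type*} [AddCommGroup M] {G T : Finset α} {i : α}
    (hi : i ∈ T) (hiG : i ∉ G) (f : Finset α → M)
    (hf : ∀ B, G ⊆ B → B ⊆ T → i ∉ B → f (insert i B) = f B) : moebiusSum f T G = 0 := by
  rw [moebiusSum, sum_Icc_neg_one_pow_eq_zero hi hiG f hf, neg_zero]

theorem exists_ne_zero_of_moebiusSum_ne_zero {M : Type*} [AddCommGroup M] {G T : Finset α}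
    {f : Finset α → M} (h : moebiusSum f T G ≠ 0) : ∃ B, G ⊆ B ∧ B ⊆ T ∧ f B ≠ 0 := by
  rw [moebiusSum, neg_ne_zero] at h
  obtain ⟨B, hB, hne⟩ := exists_ne_zero_of_sum_ne_zero h
  exact ⟨B, (mem_Icc.1 hB).1, (mem_Icc.1 hB).2, fun h0 => hne (by rw [h0, smul_zero])⟩

end Moebius

/-! ### The Hall functional, its annihilator ideal and the Chow relations modulo it -/

section HallForm

open MvPolynomial

variable {α : Type*} [DecidableEq α]

theorem prod_map_X_eq_monomial {σ : Type*} [DecidableEq σ] (s : Multiset σ) :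
    (s.map (X : σ → MvPolynomial σ ℚ)).prod = monomial (Multiset.toFinsupp s) 1 := by
  induction s using Multiset.induction_on with
  | empty => simp
  | cons a s ih =>
    rw [Multiset.map_cons, Multiset.prod_cons, ih, ← Multiset.singleton_add, map_add,
      Multiset.toFinsupp_singleton, X, monomial_mul, one_mul]

theorem linearMap_ext_prod_map_X {σ M : Type*} [AddCommGroup M] [Module ℚ M]
    {f g : MvPolynomial σ ℚ →ₗ[ℚ] M}
    (h : ∀ s : Multiset σ, f (s.map X).prod = g (s.map X).prod) : f = g := by
  classical
  refine (basisMonomials σ ℚ).ext fun e => ?_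
  have := h (Finsupp.toMultiset e)
  rwa [prod_map_X_eq_monomial, Finsupp.toMultiset_toFinsupp] at this

/-- The linear functional which sends a monomial `X_{A_1} ⋯ X_{A_d}` to `1` if `A_1, …, A_d`
satisfy Hall's condition, and all other monomials to `0`. -/
noncomputable def hallForm (d : ℕ) : MvPolynomial (Finset α) ℚ →ₗ[ℚ] ℚ :=
  (basisMonomials (Finset α) ℚ).constr ℚ fun e => hallIndicator d (Finsupp.toMultiset e)

theorem hallForm_prod (d : ℕ) (s : Multiset (Finset α)) :
    hallForm d (s.map X).prod = hallIndicator d s := by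
  rw [prod_map_X_eq_monomial]
  have := (basisMonomials (Finset α) ℚ).constr_basis ℚ
    (fun e => hallIndicator d (Finsupp.toMultiset e)) (Multiset.toFinsupp s)
  rwa [coe_basisMonomials, Multiset.toFinsupp_toMultiset] at this

/-- The ideal of all `r` such that `hallForm d` vanishes on all multiples of `r`. -/
noncomputable def hallIdeal (α : Type*) [DecidableEq α] (d : ℕ) :
    Ideal (MvPolynomial (Finset α) ℚ) where
  carrier := {r | ∀ p, hallForm d (r * p) = 0}
  zero_mem' p := by simp
  add_mem' ha hb p := by rw [add_mul, map_add, ha p, hb p, add_zero]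
  smul_mem' c r hr p := by
    rw [smul_eq_mul, mul_comm c, mul_assoc]
    exact hr _

theorem mem_hallIdeal_iff {d : ℕ} {r : MvPolynomial (Finset α) ℚ} :
    r ∈ hallIdeal α d ↔ ∀ s : Multiset (Finset α), hallForm d (r * (s.map X).prod) = 0 := by
  refine ⟨fun h s => h _, fun h p => ?_⟩
  have : (hallForm d).comp (LinearMap.mulLeft ℚ r) = 0 := linearMap_ext_prod_map_X h
  exact LinearMap.congr_fun this p

theorem X_mul_prod (A : Finset α) (s : Multiset (Finset α)) :
    (X A * (s.map X).prod : MvPolynomial (Finset α) ℚ) = ((A ::ₘ s).map X).prod := by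
  simp

theorem X_sub_mul_X_sub_mem_hallIdeal (d : ℕ) {A A' B B' : Finset α}
    (hA : A ⊆ A') (hA' : A' ⊆ A ∪ B) (hB : B ⊆ B') (hB' : B' ⊆ A ∪ B) :
    (X A - X A') * (X B - X B') ∈ hallIdeal α d := by
  rw [mem_hallIdeal_iff]
  intro s
  have : (X A - X A') * (X B - X B') * (s.map X).prod =
      ((A ::ₘ B ::ₘ s).map X).prod - ((A' ::ₘ B ::ₘ s).map X).prod -
        ((A ::ₘ B' ::ₘ s).map X).prod +
        ((A' ::ₘ B' ::ₘ s).map (X : _ → MvPolynomial (Finset α) ℚ)).prod := by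
    simp only [← X_mul_prod]; ring
  rw [this, map_add, map_sub, map_sub]
  simp only [hallForm_prod]
  exact hallIndicator_exchange d s hA hA' hB hB'

theorem X_singleton_mul_sub_mem_hallIdeal (d : ℕ) (i : α) (A : Finset α) :
    X {i} * (X (insert i A) - X A) ∈ hallIdeal α d := by
  rw [mem_hallIdeal_iff]
  intro s
  have : X {i} * (X (insert i A) - X A) * (s.map X).prod =
      (({i} ::ₘ insert i A ::ₘ s).map X).prod -
        (({i} ::ₘ A ::ₘ s).map (X : _ → MvPolynomial (Finset α) ℚ)).prod := by
    simp only [← X_mul_prod]; ring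
  rw [this, map_sub, hallForm_prod, hallForm_prod, hallIndicator_singleton_insert d s i A, sub_self]

theorem X_sub_X_univ_mem_hallIdeal [Fintype α] {d : ℕ} {A : Finset α} (hA : d ≤ A.card) :
    X A - X univ ∈ hallIdeal α d := by
  rw [mem_hallIdeal_iff]
  intro s
  rw [sub_mul, map_sub, X_mul_prod, X_mul_prod, hallForm_prod, hallForm_prod,
    hallIndicator_large d s hA, sub_self]

theorem X_empty_mem_hallIdeal (d : ℕ) : X ∅ ∈ hallIdeal α d := by
  rw [mem_hallIdeal_iff]
  intro s
  rw [X_mul_prod, hallForm_prod, hallIndicator_eq_zero (not_hallCondition_empty_cons s)]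

theorem mk_hallIdeal_eq {d : ℕ} {p q : MvPolynomial (Finset α) ℚ} (h : p - q ∈ hallIdeal α d) :
    Ideal.Quotient.mk (hallIdeal α d) p = Ideal.Quotient.mk (hallIdeal α d) q :=
  Ideal.Quotient.eq.2 h

/-- Toggle an element `j` of `G \ F` in the first sum and an element `i` of `F \ G` in the second.
Every `A ⊇ F` contains `i` and every `B ⊇ G` contains `j`, so the exchange relation applies to `A ⊆
insert j A` and `B ⊆ insert i B`. -/
theorem moebiusSum_mul_moebiusSum_mem_hallIdeal [Fintype α] (d : ℕ) {F G : Finset α}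
    (hFG : ¬ F ⊆ G) (hGF : ¬ G ⊆ F) :
    moebiusSum X univ F * moebiusSum X univ G ∈ hallIdeal α d := by
  obtain ⟨i, hiF, hiG⟩ := not_subset.1 hFG
  obtain ⟨j, hjG, hjF⟩ := not_subset.1 hGF
  rw [← Ideal.Quotient.eq_zero_iff_mem, moebiusSum_mul, map_moebiusSum]
  refine moebiusSum_eq_zero (mem_univ j) hjF _ fun A hFA _ hjA => mk_hallIdeal_eq ?_
  rw [← sub_mul, ← Ideal.Quotient.eq_zero_iff_mem, mul_moebiusSum, map_moebiusSum]
  refine moebiusSum_eq_zero (mem_univ i) hiG _ fun B hGB _ hiB => mk_hallIdeal_eq ?_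
  rw [← mul_sub]
  have := X_sub_mul_X_sub_mem_hallIdeal d (subset_insert j A)
    (insert_subset (mem_union_right _ (hGB hjG)) subset_union_left) (subset_insert i B)
    (insert_subset (mem_union_left _ (hFA hiF)) subset_union_right)
  rwa [← neg_sub, neg_mul, ← neg_sub (X B), mul_neg, neg_neg]

theorem X_singleton_mul_moebiusSum_mem_hallIdeal [Fintype α] (d : ℕ) {i : α} {F : Finset α}
    (hi : i ∉ F) : X {i} * moebiusSum X univ F ∈ hallIdeal α d := by
  rw [← Ideal.Quotient.eq_zero_iff_mem, mul_moebiusSum, map_moebiusSum]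
  refine moebiusSum_eq_zero (mem_univ i) hi _ fun B _ _ _ => mk_hallIdeal_eq ?_
  rw [← mul_sub]
  exact X_singleton_mul_sub_mem_hallIdeal d i B

theorem moebiusSum_mem_hallIdeal [Fintype α] {d : ℕ} {F : Finset α}
    (hF : d ≤ F.card) (hne : F ≠ univ) : moebiusSum X univ F ∈ hallIdeal α d := by
  obtain ⟨i, -, hi⟩ := exists_of_ssubset (ssubset_univ_iff.2 hne)
  rw [← Ideal.Quotient.eq_zero_iff_mem, map_moebiusSum]
  refine moebiusSum_eq_zero (mem_univ i) hi _ fun B hB _ _ => ?_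
  rw [mk_hallIdeal_eq (X_sub_X_univ_mem_hallIdeal (hF.trans (card_le_card hB))),
    mk_hallIdeal_eq (X_sub_X_univ_mem_hallIdeal
      (hF.trans (card_le_card (hB.trans (subset_insert i B)))))]

/-- The sign (-1)^|B \ F| differs from (-1)^|F \ A| by the constant (-1)^|B \ A|, so this is the
alternating sum over an interval. -/
theorem sum_Icc_neg_one_pow_card_sdiff (A B : Finset α) :
    ∑ F ∈ Icc A B, (-1 : ℤ) ^ (B \ F).card = if A = B then 1 else 0 := by
  split_ifs with h
  · simp [h]
  by_cases hAB : A ⊆ B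
  swap
  · rw [Icc_eq_empty hAB, sum_empty]
  have h1 := sum_Icc_neg_one_pow_const_eq_zero (hAB.ssubset_of_ne h) (1 : ℤ)
  have h2 : ∀ F ∈ Icc A B, (-1 : ℤ) ^ (B \ F).card =
      (-1) ^ (B \ A).card * ((-1 : ℤ) ^ (F \ A).card • 1) := by
    intro F hF
    rw [mem_Icc] at hF
    have h3 := card_sdiff_add_card_eq_card hF.1
    have h4 := card_sdiff_add_card_eq_card hF.2
    have h5 := card_sdiff_add_card_eq_card hAB
    rw [show (B \ A).card = (B \ F).card + (F \ A).card by omega, pow_add, smul_eq_mul, mul_one,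
      mul_assoc, ← pow_add, Even.neg_one_pow ⟨_, rfl⟩, mul_one]
  rw [sum_congr rfl h2, ← mul_sum, h1, mul_zero]

/-- Moebius inversion: the sums of the `moebiusSum h univ F` over all `F` which do not contain
`A`. -/
theorem sum_moebiusSum [Fintype α] {M : Type*} [AddCommGroup M] (h : Finset α → M)
    (A : Finset α) :
    ∑ F with ¬ A ⊆ F, moebiusSum h univ F = h A - h ∅ := by
  have h1 : ∀ F : Finset α, moebiusSum h univ F =
      -∑ B, (if F ⊆ B then (-1 : ℤ) ^ (B \ F).card else 0) • h B := by
    intro F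
    rw [moebiusSum, ← sum_filter_add_sum_filter_not univ (F ⊆ ·)]
    rw [sum_eq_zero (s := univ.filter fun B => ¬ F ⊆ B) fun B hB => by
      rw [if_neg (mem_filter.1 hB).2, zero_smul], add_zero]
    congr 1
    refine sum_congr (by ext B; simp) fun B hB => ?_
    rw [if_pos (mem_filter.1 hB).2]
  have h2 : ∀ B : Finset α,
      ∑ F with ¬ A ⊆ F, (if F ⊆ B then (-1 : ℤ) ^ (B \ F).card else 0) =
        (if ∅ = B then 1 else 0) - if A = B then 1 else 0 := by
    intro B
    rw [← sum_Icc_neg_one_pow_card_sdiff, ← sum_Icc_neg_one_pow_card_sdiff, eq_sub_iff_add_eq,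
      ← sum_filter, filter_filter,
      show Icc A B = (Icc ∅ B).filter (A ⊆ ·) by ext F; simp [and_comm],
      show (univ.filter fun F => ¬ A ⊆ F ∧ F ⊆ B) = (Icc ∅ B).filter (fun F => ¬ A ⊆ F) by
        ext F; simp [and_comm],
      add_comm, sum_filter_add_sum_filter_not]
  simp only [h1]
  rw [sum_neg_distrib, sum_comm]
  have h3 : ∀ B : Finset α, ∑ F with ¬ A ⊆ F,
      (if F ⊆ B then (-1 : ℤ) ^ (B \ F).card else 0) • h B =
        (if ∅ = B then h B else 0) - if A = B then h B else 0 := by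
    intro B
    rw [← sum_smul, h2, sub_smul, ite_smul, ite_smul, one_smul, zero_smul]
  rw [sum_congr rfl fun B _ => h3 B, sum_sub_distrib, sum_ite_eq, sum_ite_eq]
  simp

end HallForm

/-! ### Dual elements and triangularity of the pairing -/

section DualChain

open MvPolynomial

variable {α : Type*} [DecidableEq α]

/-- The data `G`, `τ`, `ν`, `c` of a chain `c` of finite sets with largest member `G`, and of two
multisets of members of the chain, whose multiplicities add up to the size of the first member,
respectively to one less than the size of the gap between consecutive members. -/
inductive DualChain : Finset α → Multiset (Finset α) → Multiset (Finset α) →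
    Multiset (Finset α) → Prop
  | start (G : Finset α) : DualChain G (Multiset.replicate G.card G) 0 {G}
  | step {G' G : Finset α} {τ ν c : Multiset (Finset α)} {a b : ℕ} (h : DualChain G' τ ν c)
      (hG : G' ⊂ G) (hab : G'.card + a + b + 1 = G.card) :
      DualChain G (τ + Multiset.replicate a G) (ν + Multiset.replicate b G) (G ::ₘ c)

theorem DualChain.card_add_card {G : Finset α} {τ ν c : Multiset (Finset α)}
    (h : DualChain G τ ν c) : τ.card + ν.card + c.card = G.card + 1 := by
  induction h with
  | start G => simp
  | step h hG hab ih => simp; omega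

theorem DualChain.subset_of_mem {G : Finset α} {τ ν c : Multiset (Finset α)}
    (h : DualChain G τ ν c) :
    (∀ A ∈ τ, A ⊆ G) ∧ (∀ A ∈ ν, A ⊆ G) ∧ ∀ A ∈ c, A ⊆ G := by
  induction h with
  | start G => simp +contextual [Multiset.mem_replicate]
  | step h hG hab ih =>
    obtain ⟨h1, h2, h3⟩ := ih
    refine ⟨fun A hA => ?_, fun A hA => ?_, fun A hA => ?_⟩
    · rcases Multiset.mem_add.1 hA with hA | hA
      · exact (h1 A hA).trans hG.1
      · rw [Multiset.eq_of_mem_replicate hA]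
    · rcases Multiset.mem_add.1 hA with hA | hA
      · exact (h2 A hA).trans hG.1
      · rw [Multiset.eq_of_mem_replicate hA]
    · rcases Multiset.mem_cons.1 hA with rfl | hA
      · rfl
      · exact (h3 A hA).trans hG.1

/-- A non-zero value of a linear functional on a product of alternating sums comes from a
non-zero value on one of the monomials. -/
theorem exists_of_prod_moebiusSum_ne_zero (T : Finset α) (c : Multiset (Finset α))
    (f : MvPolynomial (Finset α) ℚ →ₗ[ℚ] ℚ) (h : f (c.map (moebiusSum X T)).prod ≠ 0) :
    ∃ b : Multiset (Finset α), Multiset.Rel (· ⊆ ·) c b ∧ (∀ B ∈ b, B ⊆ T) ∧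
      f (b.map X).prod ≠ 0 := by
  induction c using Multiset.induction_on generalizing f with
  | empty => exact ⟨0, Multiset.rel_zero_left.2 rfl, by simp, by simpa using h⟩
  | cons G c ih =>
    rw [Multiset.map_cons, Multiset.prod_cons, moebiusSum_mul, map_moebiusSum] at h
    obtain ⟨B, hGB, hBT, hB⟩ := exists_ne_zero_of_moebiusSum_ne_zero h
    obtain ⟨b, h1, h2, h3⟩ := ih (f.comp (LinearMap.mulLeft ℚ (X B))) hB
    refine ⟨B ::ₘ b, Multiset.Rel.cons hGB h1, ?_, by simpa using h3⟩
    simp only [Multiset.mem_cons]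
    rintro C (rfl | hC)
    exacts [hBT, h2 C hC]

/-- The comparison of multisets behind the triangularity of the pairing. -/
def Dominates (G : Finset α) (τ s : Multiset (Finset α)) : Prop :=
  τ.card ≤ (s.filter (· ⊆ G)).card ∧
  (τ.map fun A => G.card - A.card).sum ≤
    ((s.filter (· ⊆ G)).map fun A => G.card - A.card).sum ∧
  ((τ.map fun A => G.card - A.card).sum =
    ((s.filter (· ⊆ G)).map fun A => G.card - A.card).sum →
    ∃ k, s.filter (· ⊆ G) = τ + Multiset.replicate k G)

theorem eq_replicate_of_sum_card_sub_eq_zero {G : Finset α} {s : Multiset (Finset α)}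
    (hs : ∀ A ∈ s, A ⊆ G) (h : (s.map fun A => G.card - A.card).sum = 0) :
    s = Multiset.replicate s.card G := by
  rw [Multiset.eq_replicate]
  refine ⟨rfl, fun A hA => eq_of_subset_of_card_le (hs A hA) ?_⟩
  have := Multiset.sum_eq_zero_iff.1 h _ (Multiset.mem_map_of_mem _ hA)
  omega

theorem dominates_replicate {G : Finset α} {s : Multiset (Finset α)} {k : ℕ}
    (h : k ≤ (s.filter (· ⊆ G)).card) : Dominates G (Multiset.replicate k G) s := by
  refine ⟨by simpa using h, by simp, fun h0 => ?_⟩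
  rw [Multiset.map_replicate, Nat.sub_self, Multiset.sum_replicate, smul_zero] at h0
  refine ⟨(s.filter (· ⊆ G)).card - k, ?_⟩
  rw [← Multiset.replicate_add, Nat.add_sub_cancel' h]
  exact eq_replicate_of_sum_card_sub_eq_zero (fun A hA => (Multiset.mem_filter.1 hA).2) h0.symm

theorem sum_card_sub_of_subset {G' G : Finset α} (hG : G' ⊆ G) {s : Multiset (Finset α)}
    (hs : ∀ A ∈ s, A ⊆ G') :
    (s.map fun A => G.card - A.card).sum =
      (s.map fun A => G'.card - A.card).sum + s.card * (G.card - G'.card) := by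
  induction s using Multiset.induction_on with
  | empty => simp
  | cons A s ih =>
    have h1 := card_le_card hG
    have h2 := card_le_card (hs A (Multiset.mem_cons_self _ _))
    rw [Multiset.map_cons, Multiset.sum_cons, ih fun B hB => hs B (Multiset.mem_cons_of_mem hB),
      Multiset.map_cons, Multiset.sum_cons, Multiset.card_cons, add_mul, one_mul]
    omega

/-- Measured from `G` instead of `G'`, each member inside `G'` weighs |G| - |G'| more, and the
members of `s` in `G` but not in `G'` only add weight. Equality therefore forces equal numbers of
members inside `G'`, equality at the level of `G'`, and that all remaining members are `G`. -/
theorem Dominates.step {G' G : Finset α} (hG : G' ⊂ G) {τ s : Multiset (Finset α)} {a : ℕ}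
    (h : Dominates G' τ s) (hτ : ∀ A ∈ τ, A ⊆ G')
    (hc : τ.card + a ≤ (s.filter (· ⊆ G)).card) :
    Dominates G (τ + Multiset.replicate a G) s := by
  obtain ⟨h1, h2, h3⟩ := h
  have hlt := card_lt_card hG
  set u := (s.filter (· ⊆ G)).filter fun A => ¬ A ⊆ G' with hu
  have hsplit : s.filter (· ⊆ G) = s.filter (· ⊆ G') + u := by
    conv_lhs => rw [← Multiset.filter_add_not (· ⊆ G') (s.filter (· ⊆ G))]
    rw [Multiset.filter_filter]
    congr 1
    refine Multiset.filter_congr fun A _ => ⟨fun h => h.1, fun h => ⟨h, h.trans hG.1⟩⟩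
  have huG : ∀ A ∈ u, A ⊆ G := fun A hA => by
    rw [hu, Multiset.mem_filter, Multiset.mem_filter] at hA
    exact hA.1.2
  have e1 := sum_card_sub_of_subset hG.1 hτ
  have e2 := sum_card_sub_of_subset (s := s.filter (· ⊆ G')) hG.1
    (fun A hA => (Multiset.mem_filter.1 hA).2)
  have e3 : ((τ + Multiset.replicate a G).map fun A => G.card - A.card).sum =
      (τ.map fun A => G.card - A.card).sum := by simp
  have e4 : ((s.filter (· ⊆ G)).map fun A => G.card - A.card).sum =
      ((s.filter (· ⊆ G')).map fun A => G.card - A.card).sum +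
        (u.map fun A => G.card - A.card).sum := by
    rw [hsplit, Multiset.map_add, Multiset.sum_add]
  have h4 := Nat.mul_le_mul_right (G.card - G'.card) h1
  refine ⟨by simpa using hc, by omega, fun heq => ?_⟩
  have h5 : τ.card * (G.card - G'.card) =
      (s.filter (· ⊆ G')).card * (G.card - G'.card) := by omega
  have h6 := Nat.eq_of_mul_eq_mul_right (by omega) h5
  obtain ⟨k, hk⟩ := h3 (by omega)
  have hk0 : k = 0 := by
    have := congrArg Multiset.card hk
    simp at this
    omega
  have hu0 := eq_replicate_of_sum_card_sub_eq_zero huG (by omega)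
  rw [hk0, Multiset.replicate_zero, add_zero] at hk
  refine ⟨u.card - a, ?_⟩
  have hua : a ≤ u.card := by
    rw [hsplit, Multiset.card_add] at hc; omega
  rw [hsplit, hk, add_assoc, ← Multiset.replicate_add, Nat.add_sub_cancel' hua]
  exact congrArg (τ + ·) hu0

/-- Expand all alternating sums except that of `G`. A non-zero term yields at least |G| factors
inside `G`; those from `pre` are too large to qualify, and those from `c` number at most `c.card`.
-/
theorem card_le_of_hallForm_ne_zero {D : ℕ} {G T : Finset α} (hGT : G ⊂ T)
    {c pre w : Multiset (Finset α)} (hpre : ∀ H ∈ pre, ¬ H ⊆ G) (hw : ∀ H ∈ w, H ⊆ T)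
    (h : hallForm D (((pre + G ::ₘ c).map (moebiusSum X T)).prod * (w.map X).prod) ≠ 0) :
    G.card ≤ c.card + (w.filter (· ⊆ G)).card := by
  have e : ((pre + G ::ₘ c).map (moebiusSum X T)).prod * (w.map X).prod =
      (moebiusSum X T G * (w.map X).prod) *
        ((pre + c).map (moebiusSum (X : _ → MvPolynomial (Finset α) ℚ) T)).prod := by
    simp only [Multiset.map_add, Multiset.prod_add, Multiset.map_cons, Multiset.prod_cons]; ring
  rw [e] at h
  obtain ⟨b, h1, h2, h3⟩ := exists_of_prod_moebiusSum_ne_zero T (pre + c)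
    ((hallForm D).comp (LinearMap.mulLeft ℚ (moebiusSum X T G * (w.map X).prod)))
    (by rwa [LinearMap.comp_apply, LinearMap.mulLeft_apply])
  obtain ⟨b1, b2, hb1, hb2, rfl⟩ := Multiset.rel_add_left.1 h1
  rw [LinearMap.comp_apply, LinearMap.mulLeft_apply, mul_assoc, ← Multiset.prod_add,
    ← Multiset.map_add, moebiusSum_mul, map_moebiusSum, moebiusSum, neg_ne_zero] at h3
  simp only [X_mul_prod, hallForm_prod] at h3
  have h4 := card_le_card_filter_of_sum_hallIndicator_ne_zero hGT (by
    intro A hA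
    rcases Multiset.mem_add.1 hA with hA | hA
    exacts [hw A hA, h2 A hA]) h3
  rw [Multiset.filter_add, Multiset.filter_add, Multiset.card_add, Multiset.card_add] at h4
  have h5 : b1.filter (· ⊆ G) = 0 := by
    rw [Multiset.filter_eq_nil]
    intro B hB hBG
    obtain ⟨H, hH, hHB⟩ := Multiset.exists_mem_of_rel_of_mem (Multiset.rel_flip.2 hb1) hB
    exact hpre H hH (hHB.trans hBG)
  have h6 := Multiset.card_le_card (Multiset.filter_le (· ⊆ G) b2)
  rw [← Multiset.card_eq_card_of_rel hb2] at h6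
  rw [h5, Multiset.card_zero] at h4
  omega

/-- At each member `G` of the chain, the bound by |G| of the previous lemma, minus the contributions
of the chain and of `ν` below `G`, leaves exactly the number of members of `τ` up to `G` that `s`
has to match. Here `pre` and `ρ` collect what the larger members of the chain contribute. -/
theorem DualChain.dominates {D : ℕ} {G T : Finset α} {τ ν c : Multiset (Finset α)}
    (hd : DualChain G τ ν c) (hGT : G ⊂ T) {pre ρ s : Multiset (Finset α)}
    (hpre : ∀ H ∈ pre, ¬ H ⊆ G) (hρ : ∀ H ∈ ρ, ¬ H ⊆ G) (hρT : ∀ H ∈ ρ, H ⊆ T)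
    (hsT : ∀ H ∈ s, H ⊆ T)
    (h : hallForm D (((pre + c).map (moebiusSum X T)).prod *
      ((ν + ρ + s).map X).prod) ≠ 0) : Dominates G τ s := by
  induction hd generalizing pre ρ with
  | start G =>
    refine dominates_replicate ?_
    have h1 := card_le_of_hallForm_ne_zero (c := 0) hGT hpre (by
      intro H hH
      rw [zero_add] at hH
      rcases Multiset.mem_add.1 hH with hH | hH
      exacts [hρT H hH, hsT H hH]) h
    rwa [zero_add, Multiset.filter_add, Multiset.filter_eq_nil.2 hρ, Multiset.card_zero,
      zero_add, zero_add] at h1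
  | @step G' G τ ν c a b hd hG hab ih =>
    have hν := hd.subset_of_mem.2.1
    have h1 := card_le_of_hallForm_ne_zero (c := c) hGT hpre (by
      intro H hH
      rcases Multiset.mem_add.1 hH with hH | hH
      · rcases Multiset.mem_add.1 hH with hH | hH
        · rcases Multiset.mem_add.1 hH with hH | hH
          · exact ((hν H hH).trans hG.1).trans hGT.1
          · rw [Multiset.eq_of_mem_replicate hH]; exact hGT.1
        · exact hρT H hH
      · exact hsT H hH) h
    rw [Multiset.filter_add, Multiset.filter_add, Multiset.filter_eq_nil.2 hρ,
      Multiset.card_add, Multiset.card_add, Multiset.card_zero, add_zero] at h1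
    have h2 := Multiset.card_le_card (Multiset.filter_le (· ⊆ G) (ν + Multiset.replicate b G))
    have h3 := hd.card_add_card
    rw [Multiset.card_add, Multiset.card_replicate] at h2
    refine (ih (hG.trans hGT) (pre := G ::ₘ pre) (ρ := Multiset.replicate b G + ρ)
      ?_ ?_ ?_ ?_).step hG hd.subset_of_mem.1 (by omega)
    · intro H hH hHG
      rcases Multiset.mem_cons.1 hH with rfl | hH
      · exact hG.2 hHG
      · exact hpre H hH (hHG.trans hG.1)
    · intro H hH hHG
      rcases Multiset.mem_add.1 hH with hH | hH
      · rw [Multiset.eq_of_mem_replicate hH] at hHG; exact hG.2 hHG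
      · exact hρ H hH (hHG.trans hG.1)
    · intro H hH
      rcases Multiset.mem_add.1 hH with hH | hH
      · rw [Multiset.eq_of_mem_replicate hH]; exact hGT.1
      · exact hρT H hH
    · rwa [Multiset.cons_add, ← Multiset.add_cons, ← add_assoc ν]

end DualChain

/-! ### The diagonal entries of the pairing -/

section Diagonal

open MvPolynomial

variable {α : Type*} [DecidableEq α]

theorem hallCondition_of_card_le {s : Multiset (Finset α)} (h : ∀ A ∈ s, s.card ≤ A.card) :
    HallCondition s := by
  intro t ht
  rcases t.empty_or_exists_mem with rfl | ⟨A, hA⟩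
  · simp
  · exact (Multiset.card_le_card ht).trans ((h A (Multiset.mem_of_le ht hA)).trans
      (card_le_card (Multiset.le_sup hA)))

theorem hallIndicator_replicate {k : ℕ} {G : Finset α} (h : k ≤ G.card) :
    hallIndicator k (Multiset.replicate k G) = 1 := by
  rw [hallIndicator, if_pos]
  refine ⟨by simp, hallCondition_of_card_le fun A hA => ?_⟩
  rw [Multiset.eq_of_mem_replicate hA]; simpa using h

theorem le_of_le_add_replicate {t w : Multiset (Finset α)} {e : ℕ} {T : Finset α}
    (h : t ≤ w + Multiset.replicate e T) (hT : T ∉ t) : t ≤ w := by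
  rw [Multiset.le_iff_count] at h ⊢
  intro A
  by_cases hA : A = T
  · rw [hA, Multiset.count_eq_zero_of_notMem hT]; exact Nat.zero_le _
  · have := h A
    rwa [Multiset.count_add, Multiset.count_replicate, if_neg (Ne.symm hA), add_zero] at this

/-- The algebra endomorphism which sets to zero all variables of sets not contained in `S`. -/
noncomputable def restrictTo (S : Finset α) :
    MvPolynomial (Finset α) ℚ →ₐ[ℚ] MvPolynomial (Finset α) ℚ :=
  aeval fun B => if B ⊆ S then X B else 0

theorem restrictTo_X (S B : Finset α) : restrictTo S (X B) = if B ⊆ S then X B else 0 :=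
  aeval_X _ _

theorem restrictTo_prod_of_subset {S : Finset α} {w : Multiset (Finset α)}
    (h : ∀ A ∈ w, A ⊆ S) : restrictTo S (w.map X).prod = (w.map X).prod := by
  rw [map_multiset_prod, Multiset.map_map]
  congr 1
  refine Multiset.map_congr rfl fun A hA => ?_
  rw [Function.comp_apply, restrictTo_X, if_pos (h A hA)]

theorem restrictTo_prod_of_not_subset {S : Finset α} {w : Multiset (Finset α)}
    (h : ¬ ∀ A ∈ w, A ⊆ S) : restrictTo S (w.map X).prod = 0 := by
  push Not at h
  obtain ⟨A, hA, hAS⟩ := h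
  rw [map_multiset_prod, Multiset.map_map]
  refine Multiset.prod_eq_zero (Multiset.mem_map.2 ⟨A, hA, ?_⟩)
  rw [Function.comp_apply, restrictTo_X, if_neg hAS]

theorem restrictTo_moebiusSum {S T : Finset α} (hST : S ⊆ T) (G : Finset α) :
    restrictTo S (moebiusSum X T G) = moebiusSum X S G := by
  rw [map_moebiusSum, moebiusSum, moebiusSum]
  congr 1
  have : Icc G S ⊆ Icc G T := Icc_subset_Icc_right hST
  rw [← sum_subset this]
  · refine sum_congr rfl fun B hB => ?_
    rw [restrictTo_X, if_pos (mem_Icc.1 hB).2]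
  · intro B hB hB'
    rw [restrictTo_X, if_neg, smul_zero]
    intro h
    exact hB' (mem_Icc.2 ⟨(mem_Icc.1 hB).1, h⟩)

/-- Multiplication by the alternating sum at `G` localizes to `G`. A non-zero value gives a tight
multiset inside `G` with at least |G| members; since `w` has only |G| members, it is that multiset.
The `e` copies of `T` never obstruct Hall's condition because |T| ≥ |G| + 1 + e. -/
theorem hallForm_moebiusSum_mul_prod {G T : Finset α} (hGT : G ⊂ T) {e : ℕ}
    (he : G.card + 1 + e ≤ T.card) {w : Multiset (Finset α)} (hw : ∀ A ∈ w, A ⊆ T) :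
    hallForm (G.card + 1 + e)
        (moebiusSum X T G * ((w + Multiset.replicate e T).map X).prod) =
      hallForm G.card (restrictTo G (w.map X).prod) := by
  classical
  rw [moebiusSum_mul, map_moebiusSum, moebiusSum]
  simp only [X_mul_prod, hallForm_prod]
  by_cases hc : w.card = G.card
  swap
  · rw [sum_eq_zero, neg_zero]
    · by_cases h : ∀ A ∈ w, A ⊆ G
      · rw [restrictTo_prod_of_subset h, hallForm_prod, hallIndicator, if_neg (by tauto)]
      · rw [restrictTo_prod_of_not_subset h, map_zero]
    · intro B _
      rw [hallIndicator, if_neg, smul_zero]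
      rintro ⟨h, -⟩
      simp at h
      omega
  rw [sum_hallIndicator_cons hGT (by simp; omega)]
  have hTG : ∀ t : Multiset (Finset α), T ∈ t → T.card ≤ t.sup.card := fun t h =>
    card_le_card (Multiset.le_sup h)
  by_cases h : ∀ A ∈ w, A ⊆ G
  · rw [restrictTo_prod_of_subset h, hallForm_prod, hallIndicator]
    by_cases hH : HallCondition w
    · have hHs : HallCondition (w + Multiset.replicate e T) := by
        intro t ht
        by_cases hT : T ∈ t
        · have h1 := Multiset.card_le_card ht
          have h2 := hTG t hT
          rw [Multiset.card_add, Multiset.card_replicate] at h1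
          omega
        · exact hH t (le_of_le_add_replicate ht hT)
      rw [if_pos (c := w.card = G.card ∧ _) ⟨hc, hH⟩, if_pos, neg_neg]
      refine ⟨hHs, ?_, ?_⟩
      · refine not_hallCondition_cons_of_tight (t := w) (Multiset.le_add_right _ _) ?_
        rw [union_eq_left.2 (Multiset.sup_le.2 h), hc]
      · intro i hi hiG
        rw [hallCondition_cons_iff]
        refine ⟨hHs, fun t ht => ?_⟩
        by_cases hT : T ∈ t
        · have h1 := Multiset.card_le_card ht
          have h2 := hTG t hT
          have h3 := card_le_card (subset_union_right : t.sup ⊆ insert i G ∪ t.sup)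
          rw [Multiset.card_add, Multiset.card_replicate] at h1
          omega
        · have h1 := Multiset.card_le_card (le_of_le_add_replicate ht hT)
          have h3 := card_le_card (subset_union_left : insert i G ⊆ insert i G ∪ t.sup)
          rw [card_insert_of_notMem hiG] at h3
          omega
    · rw [if_neg (c := w.card = G.card ∧ _) (by tauto), if_neg, neg_zero]
      rintro ⟨h1, -⟩
      exact hH (h1.of_le (Multiset.le_add_right _ _))
  · rw [restrictTo_prod_of_not_subset h, map_zero, if_neg, neg_zero]
    rintro ⟨h0, h1, h2⟩
    refine h ?_
    obtain ⟨t, ht, htc⟩ := exists_tight_of_not_hallCondition_cons h0 h1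
    have hsub : ∀ A ∈ t, A ⊆ G := by
      intro A hA i hi
      by_contra hiG
      have hAT : A ⊆ T := by
        rcases Multiset.mem_add.1 (Multiset.mem_of_le ht hA) with h' | h'
        · exact hw A h'
        · rw [Multiset.eq_of_mem_replicate h']
      refine not_hallCondition_cons_of_tight (A := insert i G) ht ?_ (h2 i (hAT hi) hiG)
      rwa [insert_union, insert_eq_of_mem]
      exact mem_union_right _ (Multiset.le_sup hA hi)
    have htw := le_of_le_add_replicate ht fun hT => hGT.2 (hsub T hT)
    have h3 := card_le_card (subset_union_left : G ⊆ G ∪ t.sup)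
    rwa [← Multiset.eq_of_le_of_card_le htw (by omega)]

theorem hallForm_moebiusSum_mul {G T : Finset α} (hGT : G ⊂ T) {e : ℕ}
    (he : G.card + 1 + e ≤ T.card) (r : MvPolynomial (Finset α) ℚ) :
    hallForm (G.card + 1 + e) (moebiusSum X T G * X T ^ e * restrictTo T r) =
      hallForm G.card (restrictTo G r) := by
  have : (hallForm (G.card + 1 + e)).comp ((LinearMap.mulLeft ℚ
      (moebiusSum X T G * X T ^ e)).comp (restrictTo T).toLinearMap) =
      (hallForm G.card).comp (restrictTo G).toLinearMap := by
    refine linearMap_ext_prod_map_X fun w => ?_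
    simp only [LinearMap.comp_apply, LinearMap.mulLeft_apply, AlgHom.toLinearMap_apply]
    by_cases hw : ∀ A ∈ w, A ⊆ T
    · rw [restrictTo_prod_of_subset hw, ← hallForm_moebiusSum_mul_prod hGT he hw,
        Multiset.map_add, Multiset.prod_add, Multiset.map_replicate, Multiset.prod_replicate,
        mul_assoc, mul_comm (X T ^ e)]
    · rw [restrictTo_prod_of_not_subset hw, restrictTo_prod_of_not_subset
        fun h => hw fun A hA => (h A hA).trans hGT.1, mul_zero, map_zero, map_zero]
  exact LinearMap.congr_fun this r

/-- Localization at the largest member `G` leaves the same expression for the next member `G'`, with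
`G` in the role of `T`. The `a + b` copies of `G` from `τ` and `ν` are then the copies of the top
set, and they fill the degree up to |G|. -/
theorem DualChain.hallForm_eq_one {G : Finset α} {τ ν c : Multiset (Finset α)}
    (hd : DualChain G τ ν c) {T : Finset α} (hGT : G ⊂ T) {e : ℕ}
    (he : G.card + 1 + e ≤ T.card) :
    hallForm (G.card + 1 + e) ((c.map (moebiusSum X T)).prod *
      ((τ + ν + Multiset.replicate e T).map X).prod) = 1 := by
  induction hd generalizing T e with
  | start G =>
    have h := hallForm_moebiusSum_mul hGT he ((Multiset.replicate G.card G).map X).prod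
    rw [restrictTo_prod_of_subset fun A hA => by rw [Multiset.eq_of_mem_replicate hA]; exact hGT.1,
      restrictTo_prod_of_subset fun A hA => by rw [Multiset.eq_of_mem_replicate hA],
      hallForm_prod, hallIndicator_replicate le_rfl] at h
    rw [← h, Multiset.map_singleton, Multiset.prod_singleton, add_zero, Multiset.map_add,
      Multiset.prod_add, Multiset.map_replicate, Multiset.map_replicate, Multiset.prod_replicate,
      Multiset.prod_replicate, mul_assoc, mul_comm (X T ^ e)]
  | @step G' G τ ν c a b hd hG hab ih =>
    have h := ih hG (e := a + b) (by omega)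
    obtain ⟨hτ, hν, -⟩ := hd.subset_of_mem
    have hw : ∀ A ∈ τ + ν + Multiset.replicate (a + b) G, A ⊆ G := by
      intro A hA
      rcases Multiset.mem_add.1 hA with hA | hA
      · rcases Multiset.mem_add.1 hA with hA | hA
        · exact (hτ A hA).trans hG.1
        · exact (hν A hA).trans hG.1
      · rw [Multiset.eq_of_mem_replicate hA]
    have hres : ∀ S, G ⊆ S → S ⊆ T → restrictTo S ((c.map (moebiusSum X T)).prod *
        ((τ + ν + Multiset.replicate (a + b) G).map X).prod) =
        (c.map (moebiusSum X S)).prod *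
          ((τ + ν + Multiset.replicate (a + b) G).map X).prod := by
      intro S hGS hST
      rw [map_mul, restrictTo_prod_of_subset fun A hA => (hw A hA).trans hGS,
        map_multiset_prod, Multiset.map_map]
      congr 2
      exact Multiset.map_congr rfl fun H _ => restrictTo_moebiusSum hST H
    have h1 := hallForm_moebiusSum_mul hGT he ((c.map (moebiusSum X T)).prod *
        ((τ + ν + Multiset.replicate (a + b) G).map X).prod)
    rw [hres T hGT.1 subset_rfl, hres G subset_rfl hGT.1,
      show G.card = G'.card + 1 + (a + b) by omega, h] at h1
    rw [← h1, show G.card = G'.card + 1 + (a + b) by omega]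
    congr 1
    simp only [Multiset.map_add, Multiset.prod_add, Multiset.map_cons, Multiset.prod_cons,
      Multiset.map_replicate, Multiset.prod_replicate]
    ring

end Diagonal

/-! ### Standard multisets and straightening -/

section Standard

variable {α : Type*} [DecidableEq α]

/-- Multisets of non-empty sets which form a chain with largest member `G` (or are empty, if `G`
is), such that the first member has at most the multiplicity of its size, and every other member
has a multiplicity smaller than the gap to its predecessor. -/
inductive IsNested : Finset α → Multiset (Finset α) → Prop
  | start (G : Finset α) : IsNested G (Multiset.replicate G.card G)
  | step {G' G : Finset α} {τ : Multiset (Finset α)} {a : ℕ} (h : IsNested G' τ)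
      (hG : G' ⊂ G) (ha : 0 < a) (hab : G'.card + a < G.card) :
      IsNested G (τ + Multiset.replicate a G)

theorem IsNested.subset_of_mem {G : Finset α} {τ : Multiset (Finset α)} (h : IsNested G τ) :
    ∀ A ∈ τ, A ⊆ G := by
  induction h with
  | start G => intro A hA; rw [Multiset.eq_of_mem_replicate hA]
  | step h hG ha hab ih =>
    intro A hA
    rcases Multiset.mem_add.1 hA with hA | hA
    · exact (ih A hA).trans hG.1
    · rw [Multiset.eq_of_mem_replicate hA]

theorem IsNested.exists_dualChain {G : Finset α} {τ : Multiset (Finset α)} (h : IsNested G τ) :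
    ∃ ν c, DualChain G τ ν c := by
  induction h with
  | start G => exact ⟨_, _, .start G⟩
  | @step G' G τ a h hG ha hab ih =>
    obtain ⟨ν, c, hd⟩ := ih
    exact ⟨_, _, hd.step hG (b := G.card - G'.card - a - 1) (by omega)⟩

/-- The multisets which index the monomial basis of the augmented Chow ring of the uniform matroid
of rank `d`. -/
def IsStandard [Fintype α] (d : ℕ) (τ : Multiset (Finset α)) : Prop :=
  τ = Multiset.replicate d univ ∨
    ∃ G τ' a, IsNested G τ' ∧ G.card + a < d ∧ τ = τ' + Multiset.replicate a univ

theorem sup_mem_of_chain {τ : Multiset (Finset α)} (h0 : τ ≠ 0)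
    (hc : ∀ A ∈ τ, ∀ B ∈ τ, A ⊆ B ∨ B ⊆ A) : τ.sup ∈ τ := by
  induction τ using Multiset.induction_on with
  | empty => exact absurd rfl h0
  | cons A τ ih =>
    rw [Multiset.sup_cons]
    by_cases hτ : τ = 0
    · simp [hτ]
    have h1 := ih hτ fun A hA B hB =>
      hc A (Multiset.mem_cons_of_mem hA) B (Multiset.mem_cons_of_mem hB)
    rcases hc A (Multiset.mem_cons_self _ _) _ (Multiset.mem_cons_of_mem h1) with h | h
    · rw [sup_eq_right.2 h]; exact Multiset.mem_cons_of_mem h1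
    · rw [sup_eq_left.2 h]; exact Multiset.mem_cons_self _ _

theorem filter_ne_add_replicate_count {β : Type*} [DecidableEq β] (τ : Multiset β) (b : β) :
    τ.filter (· ≠ b) + Multiset.replicate (τ.count b) b = τ := by
  rw [← Multiset.filter_eq', add_comm]
  exact Multiset.filter_add_not (· = b) τ

theorem isNested_sup {τ : Multiset (Finset α)} (h0 : ∅ ∉ τ)
    (hc : ∀ A ∈ τ, ∀ B ∈ τ, A ⊆ B ∨ B ⊆ A) (h1 : ∀ A ∈ τ, τ.count A ≤ A.card)
    (h2 : ∀ A ∈ τ, ∀ B ∈ τ, A ⊂ B → A.card + τ.count B < B.card) : IsNested τ.sup τ := by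
  induction hn : τ.card using Nat.strong_induction_on generalizing τ with
  | _ n ih =>
  by_cases hτ : τ = 0
  · subst hτ
    exact IsNested.start ∅
  set G := τ.sup with hG
  have hGτ : G ∈ τ := sup_mem_of_chain hτ hc
  set σ := τ.filter (· ≠ G) with hσ
  have hστ : ∀ A ∈ σ, A ∈ τ := fun A hA => (Multiset.mem_filter.1 hA).1
  have hcount : ∀ A ∈ σ, σ.count A = τ.count A := fun A hA =>
    Multiset.count_filter_of_pos (Multiset.mem_filter.1 hA).2
  have hdec : σ + Multiset.replicate (τ.count G) G = τ := filter_ne_add_replicate_count τ G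
  have hpos : 0 < τ.count G := Multiset.count_pos.2 hGτ
  have ihσ : IsNested σ.sup σ := by
    refine ih σ.card ?_ (fun h => h0 (hστ _ h))
      (fun A hA B hB => hc A (hστ A hA) B (hστ B hB)) ?_ ?_ rfl
    · rw [← hn, ← congrArg Multiset.card hdec, Multiset.card_add, Multiset.card_replicate]
      omega
    · intro A hA; rw [hcount A hA]; exact h1 A (hστ A hA)
    · intro A hA B hB; rw [hcount B hB]; exact h2 A (hστ A hA) B (hστ B hB)
  by_cases hσ0 : σ = 0
  · rw [hσ0, zero_add] at hdec
    rcases (h1 G hGτ).eq_or_lt with h | h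
    · rw [← hdec, h]; exact IsNested.start G
    · have hne : G ≠ ∅ := fun h => h0 (h ▸ hGτ)
      -- A lone set with multiplicity below its size is one step above the empty set, which
      -- contributes no members.
      have := (IsNested.start (∅ : Finset α)).step (G := G) (a := τ.count G)
        (empty_ssubset.2 (nonempty_iff_ne_empty.2 hne)) hpos (by simpa using h)
      rw [card_empty, Multiset.replicate_zero, zero_add, hdec] at this
      exact this
  · have hmem : σ.sup ∈ σ := sup_mem_of_chain hσ0
      fun A hA B hB => hc A (hστ A hA) B (hστ B hB)
    have hlt : σ.sup ⊂ G :=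
      (Multiset.le_sup (hστ _ hmem)).lt_of_ne (Multiset.mem_filter.1 hmem).2
    have := ihσ.step hlt hpos (h2 _ (hστ _ hmem) _ hGτ hlt)
    rwa [hdec] at this

/-- Each hypothesis says that one of the rewriting rules for products of the h_A does not apply. The
minimum with `d` matters only for `univ`, the one member that may have `d` or more elements. -/
theorem isStandard_of_irreducible [Fintype α] {d : ℕ} {τ : Multiset (Finset α)}
    (h0 : ∅ ∉ τ) (hu : ∀ A ∈ τ, d ≤ A.card → A = univ)
    (hc : ∀ A ∈ τ, ∀ B ∈ τ, A ⊆ B ∨ B ⊆ A) (h1 : ∀ A ∈ τ, τ.count A ≤ min A.card d)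
    (h2 : ∀ A ∈ τ, ∀ B ∈ τ, A ⊂ B → A.card + τ.count B < min B.card d) : IsStandard d τ := by
  set σ := τ.filter (· ≠ univ) with hσ
  have hdec : σ + Multiset.replicate (τ.count univ) univ = τ :=
    filter_ne_add_replicate_count τ univ
  have hστ : ∀ A ∈ σ, A ∈ τ := fun A hA => (Multiset.mem_filter.1 hA).1
  have hcount : ∀ A ∈ σ, σ.count A = τ.count A := fun A hA =>
    Multiset.count_filter_of_pos (Multiset.mem_filter.1 hA).2
  have hnest : IsNested σ.sup σ := by
    refine isNested_sup (fun h => h0 (hστ _ h))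
      (fun A hA B hB => hc A (hστ A hA) B (hστ B hB)) ?_ ?_
    · intro A hA; rw [hcount A hA]; exact (h1 A (hστ A hA)).trans (min_le_left _ _)
    · intro A hA B hB hAB; rw [hcount B hB]
      exact (h2 A (hστ A hA) B (hστ B hB) hAB).trans_le (min_le_left _ _)
  have hcu : τ.count univ ≤ d := by
    by_cases h : univ ∈ τ
    · exact (h1 _ h).trans (min_le_right _ _)
    · rw [Multiset.count_eq_zero_of_notMem h]; exact Nat.zero_le _
  by_cases hσ0 : σ = 0
  · rcases hcu.eq_or_lt with h | h
    · left; rw [← hdec, hσ0, h, zero_add]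
    · right
      refine ⟨∅, 0, τ.count univ, IsNested.start ∅, by simpa using h, ?_⟩
      rw [← hσ0, hdec]
  · right
    have hmem : σ.sup ∈ σ := sup_mem_of_chain hσ0
      fun A hA B hB => hc A (hστ A hA) B (hστ B hB)
    have hne := (Multiset.mem_filter.1 hmem).2
    refine ⟨σ.sup, σ, τ.count univ, hnest, ?_, hdec.symm⟩
    by_cases h : univ ∈ τ
    · exact (h2 _ (hστ _ hmem) _ h (ssubset_univ_iff.2 hne)).trans_le (min_le_right _ _)
    · rw [Multiset.count_eq_zero_of_notMem h, add_zero]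
      by_contra hlt
      exact hne (hu _ (hστ _ hmem) (by omega))

/-- Products of elements `h A` which satisfy the relations of the augmented Chow ring are
linear combinations of standard products. -/
theorem prod_mem_span_isStandard [Fintype α] {C : Type*} [CommRing C] [Algebra ℚ C] {d : ℕ}
    {h : Finset α → C} (h_empty : h ∅ = 0)
    (h_large : ∀ A : Finset α, d ≤ A.card → h A = h univ)
    (h_union : ∀ F G, (h F - h (F ∪ G)) * (h G - h (F ∪ G)) = 0)
    (h_pow : ∀ G : Finset α, h G ^ (min G.card d + 1) = 0)
    (h_gap : ∀ F G : Finset α, F ⊂ G → F.card < d →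
      h F * h G ^ (min G.card d - F.card) = h G ^ (min G.card d - F.card + 1))
    (τ : Multiset (Finset α)) :
    (τ.map h).prod ∈ Submodule.span ℚ
      {p | ∃ σ, IsStandard d σ ∧ σ.card = τ.card ∧ p = (σ.map h).prod} := by
  -- The total codimension is the termination measure: each rule that does not give zero replaces
  -- sets by strictly larger ones.
  induction hn : (τ.map fun A => Fintype.card α - A.card).sum using Nat.strong_induction_on
    generalizing τ with
  | _ n ih =>
  have hle : ∀ A : Finset α, A.card ≤ Fintype.card α := fun A => card_le_univ A
  by_cases h0 : ∅ ∈ τ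
  · rw [Multiset.prod_eq_zero (Multiset.mem_map.2 ⟨∅, h0, h_empty⟩)]
    exact zero_mem _
  by_cases hu : ∀ A ∈ τ, d ≤ A.card → A = univ
  swap
  · push Not at hu
    obtain ⟨A, hA, hdA, hne⟩ := hu
    obtain ⟨t, rfl⟩ := Multiset.exists_cons_of_mem hA
    have hlt := card_lt_card (ssubset_univ_iff.2 hne)
    rw [card_univ] at hlt
    have := ih _ ?_ (univ ::ₘ t) rfl
    · simpa only [Multiset.map_cons, Multiset.prod_cons, h_large A hdA, Multiset.card_cons]
        using this
    · rw [← hn]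
      simp only [Multiset.map_cons, Multiset.sum_cons, card_univ]
      omega
  by_cases hc : ∀ A ∈ τ, ∀ B ∈ τ, A ⊆ B ∨ B ⊆ A
  swap
  · push Not at hc
    obtain ⟨F, hF, G, hG, hFG, hGF⟩ := hc
    obtain ⟨t, rfl⟩ := Multiset.exists_cons_of_mem hF
    rcases Multiset.mem_cons.1 hG with rfl | hG
    · exact absurd subset_rfl hFG
    obtain ⟨t, rfl⟩ := Multiset.exists_cons_of_mem hG
    have e1 : F ⊂ F ∪ G := ⟨subset_union_left, fun h => hGF (subset_union_right.trans h)⟩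
    have e2 : G ⊂ F ∪ G := ⟨subset_union_right, fun h => hFG (subset_union_left.trans h)⟩
    have l1 := card_lt_card e1
    have l2 := card_lt_card e2
    have l3 := hle (F ∪ G)
    have key : ((F ::ₘ G ::ₘ t).map h).prod = ((F ::ₘ (F ∪ G) ::ₘ t).map h).prod +
        (((F ∪ G) ::ₘ G ::ₘ t).map h).prod - (((F ∪ G) ::ₘ (F ∪ G) ::ₘ t).map h).prod := by
      simp only [Multiset.map_cons, Multiset.prod_cons]
      linear_combination (t.map h).prod * h_union F G
    rw [key]
    simp only [Multiset.map_cons, Multiset.sum_cons] at hn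
    refine sub_mem (add_mem ?_ ?_) ?_
    · simpa using ih _ (by simp only [Multiset.map_cons, Multiset.sum_cons]; omega)
        (F ::ₘ (F ∪ G) ::ₘ t) rfl
    · simpa using ih _ (by simp only [Multiset.map_cons, Multiset.sum_cons]; omega)
        ((F ∪ G) ::ₘ G ::ₘ t) rfl
    · simpa using ih _ (by simp only [Multiset.map_cons, Multiset.sum_cons]; omega)
        ((F ∪ G) ::ₘ (F ∪ G) ::ₘ t) rfl
  by_cases h1 : ∀ A ∈ τ, τ.count A ≤ min A.card d
  swap
  · push Not at h1
    obtain ⟨G, hG, hlt⟩ := h1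
    obtain ⟨t, rfl⟩ := Multiset.le_iff_exists_add.1 (Multiset.le_count_iff_replicate_le.1 hlt)
    rw [Multiset.map_add, Multiset.prod_add, Multiset.map_replicate, Multiset.prod_replicate,
      Nat.succ_eq_add_one, h_pow, zero_mul]
    exact zero_mem _
  by_cases h2 : ∀ A ∈ τ, ∀ B ∈ τ, A ⊂ B → A.card + τ.count B < min B.card d
  swap
  · push Not at h2
    obtain ⟨F, hF, G, hG, hFG, hlt⟩ := h2
    have hFd : F.card < d := by
      by_contra hFd
      have := hu F hF (by omega)
      exact (ssubset_univ_iff.1 (hFG.trans_le (subset_univ G))) this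
    obtain ⟨t, rfl⟩ := Multiset.le_iff_exists_add.1 (Multiset.le_count_iff_replicate_le.1
      (show min G.card d - F.card ≤ τ.count G by omega))
    rcases Multiset.mem_add.1 hF with hF | hF
    · exact absurd (Multiset.eq_of_mem_replicate hF) hFG.ne
    obtain ⟨t, rfl⟩ := Multiset.exists_cons_of_mem hF
    have hlt' := card_lt_card hFG
    have := hle G
    have key : ((Multiset.replicate (min G.card d - F.card) G + F ::ₘ t).map h).prod =
        ((Multiset.replicate (min G.card d - F.card + 1) G + t).map h).prod := by
      simp only [Multiset.map_add, Multiset.prod_add, Multiset.map_replicate,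
        Multiset.prod_replicate, Multiset.map_cons, Multiset.prod_cons]
      linear_combination (t.map h).prod * h_gap F G hFG hFd
    have hcard : (Multiset.replicate (min G.card d - F.card) G + F ::ₘ t).card =
        (Multiset.replicate (min G.card d - F.card + 1) G + t).card := by
      simp only [Multiset.card_add, Multiset.card_cons, Multiset.card_replicate]; omega
    rw [key, hcard]
    refine ih _ ?_ _ rfl
    rw [← hn, Multiset.replicate_succ]
    simp only [Multiset.map_cons, Multiset.sum_cons, Multiset.map_add, Multiset.sum_add]
    omega
  exact Submodule.subset_span ⟨τ, isStandard_of_irreducible h0 hu hc h1 h2, rfl, rfl⟩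

end Standard

/-! ### Straightening relations in the augmented Chow ring -/

section Relations

variable {α : Type*} [DecidableEq α] [Fintype α] {C : Type*} [CommRing C]

/-- The relations of the augmented Chow ring of the uniform matroid of rank `d`. -/
structure AugChowRelations (d : ℕ) (x : Finset α → C) (y : α → C) : Prop where
  large : ∀ F : Finset α, d ≤ F.card → x F = 0
  linear : ∀ i, y i = ∑ F with i ∉ F, x F
  incomparable : ∀ F G, ¬ F ⊆ G → ¬ G ⊆ F → x F * x G = 0
  mul_eq_zero : ∀ i F, i ∉ F → y i * x F = 0

/-- The sum of the `x F` over all `F` which do not contain `A`. -/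
def coneSum (x : Finset α → C) (A : Finset α) : C :=
  ∑ F with ¬ A ⊆ F, x F

theorem coneSum_sub {x : Finset α → C} {A B : Finset α} (h : A ⊆ B) :
    coneSum x B - coneSum x A = ∑ F with A ⊆ F ∧ ¬ B ⊆ F, x F := by
  rw [sub_eq_iff_eq_add, coneSum, coneSum,
    ← sum_filter_add_sum_filter_not (univ.filter fun F => ¬ B ⊆ F) (fun F => A ⊆ F),
    filter_filter, filter_filter]
  congr 1
  · exact sum_congr (by ext F; simp [and_comm]) fun _ _ => rfl
  · refine sum_congr ?_ fun _ _ => rfl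
    ext F
    simp only [mem_filter, mem_univ, true_and]
    exact ⟨fun hF => hF.2, fun hF => ⟨fun hB => hF (h.trans hB), hF⟩⟩

/-- Moebius inversion for `coneSum`. -/
theorem moebiusSum_coneSum (x : Finset α → C) {F : Finset α} (hF : F ≠ univ) :
    moebiusSum (coneSum x) univ F = x F := by
  have h1 : ∀ B, coneSum x B = ∑ K, x K - ∑ K with B ⊆ K, x K := by
    intro B
    rw [coneSum, eq_sub_iff_add_eq, add_comm, sum_filter_add_sum_filter_not]
  rw [moebiusSum]
  simp only [h1, smul_sub]
  rw [sum_sub_distrib, sum_Icc_neg_one_pow_const_eq_zero (ssubset_univ_iff.2 hF), zero_sub,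
    neg_neg]
  have h2 : ∀ B : Finset α, (-1 : ℤ) ^ (B \ F).card • ∑ K with B ⊆ K, x K =
      ∑ K, if B ⊆ K then (-1 : ℤ) ^ (B \ F).card • x K else 0 := by
    intro B
    rw [smul_sum, sum_filter]
  simp only [h2]
  rw [sum_comm, sum_eq_single F]
  · rw [← sum_filter, show (Icc F univ).filter (· ⊆ F) = {F} by
      ext B
      simp only [mem_filter, mem_Icc, mem_singleton]
      exact ⟨fun h => subset_antisymm h.2 h.1.1, fun h => by simp [h]⟩]
    simp
  · intro K _ hK
    rw [← sum_filter, show (Icc F univ).filter (· ⊆ K) = Icc F K by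
      ext B; simp]
    by_cases hFK : F ⊆ K
    · exact sum_Icc_neg_one_pow_const_eq_zero (hFK.ssubset_of_ne hK.symm) _
    · rw [Icc_eq_empty hFK, sum_empty]
  · simp

namespace AugChowRelations

variable {d : ℕ} {x : Finset α → C} {y : α → C}

theorem coneSum_empty (x : Finset α → C) : coneSum x ∅ = 0 := by
  simp [coneSum]

theorem coneSum_singleton (r : AugChowRelations d x y) (i : α) : coneSum x {i} = y i := by
  rw [r.linear, coneSum]
  exact sum_congr (by ext F; simp) fun _ _ => rfl

theorem coneSum_eq_sum (r : AugChowRelations d x y) {A : Finset α} (hA : d ≤ A.card) :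
    coneSum x A = ∑ F, x F := by
  rw [coneSum, ← sum_filter_add_sum_filter_not univ (A ⊆ ·), right_eq_add]
  exact sum_eq_zero fun F hF => r.large F (hA.trans (card_le_card (mem_filter.1 hF).2))

theorem coneSum_large (r : AugChowRelations d x y) {A : Finset α} (hA : d ≤ A.card) :
    coneSum x A = coneSum x univ := by
  rw [r.coneSum_eq_sum hA, r.coneSum_eq_sum (hA.trans (card_le_univ A))]

/-- The first factor involves only sets containing `F` but not `G`, the second only sets containing
`G` but not `F`; any two such sets are incomparable. -/
theorem coneSum_union (r : AugChowRelations d x y) (F G : Finset α) :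
    (coneSum x F - coneSum x (F ∪ G)) * (coneSum x G - coneSum x (F ∪ G)) = 0 := by
  rw [← neg_sub, ← neg_sub (coneSum x (F ∪ G)) (coneSum x G), neg_mul_neg,
    coneSum_sub subset_union_left, coneSum_sub subset_union_right, sum_mul_sum]
  refine sum_eq_zero fun K hK => sum_eq_zero fun L hL => ?_
  simp only [mem_filter, mem_univ, true_and, union_subset_iff, not_and] at hK hL
  exact r.incomparable K L (fun h => hL.2 (hK.1.trans h) hL.1) fun h => hK.2 hK.1 (hL.1.trans h)

/-- Split off `y i`, which kills `x K`. The remaining sets contain `i` but not all of `G`, hence are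
incomparable with `K`. -/
theorem mul_coneSum_insert (r : AugChowRelations d x y) {i : α} {G K : Finset α}
    (hGK : G ⊆ K) (hi : i ∉ K) :
    x K * coneSum x (insert i G) = 0 := by
  have h1 : coneSum x (insert i G) = y i + ∑ F with i ∈ F ∧ ¬ insert i G ⊆ F, x F := by
    rw [← r.coneSum_singleton, ← sub_eq_iff_eq_add', coneSum_sub (by simp)]
    simp
  rw [h1, mul_add, mul_comm, r.mul_eq_zero i K hi, zero_add, mul_sum]
  refine sum_eq_zero fun F hF => ?_
  simp only [mem_filter, mem_univ, true_and] at hF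
  refine r.incomparable K F (fun h => hF.2 (insert_subset hF.1 (hGK.trans h))) fun h => hi (h hF.1)

theorem coneSum_insert_sq (r : AugChowRelations d x y) (i : α) (G : Finset α) :
    coneSum x (insert i G) * coneSum x (insert i G) = coneSum x (insert i G) * coneSum x G := by
  rw [← sub_eq_zero, ← mul_sub, coneSum_sub (subset_insert i G), mul_sum]
  refine sum_eq_zero fun K hK => ?_
  simp only [mem_filter, mem_univ, true_and] at hK
  rw [mul_comm]
  exact r.mul_coneSum_insert hK.1 fun h => hK.2 (insert_subset h hK.1)

theorem coneSum_insert_pow (r : AugChowRelations d x y) (i : α) (G : Finset α) (m : ℕ) :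
    coneSum x (insert i G) ^ (m + 1) = coneSum x (insert i G) * coneSum x G ^ m := by
  induction m with
  | zero => simp
  | succ m ih =>
    rw [pow_succ, ih]
    linear_combination coneSum x G ^ m * r.coneSum_insert_sq i G

/-- Deleting an element of `G` trades all but one factor for the class of the smaller set, so the
exponent falls along with the size, down to h_∅ = 0. -/
theorem coneSum_pow (r : AugChowRelations d x y) (G : Finset α) : coneSum x G ^ (G.card + 1) = 0 := by
  induction G using Finset.induction_on with
  | empty => simp [coneSum_empty]
  | insert i G hi ih =>
    rw [card_insert_of_notMem hi, r.coneSum_insert_pow, ih, mul_zero]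

theorem coneSum_mul_pow (r : AugChowRelations d x y) {F G : Finset α} (h : F ⊆ G) {m : ℕ}
    (hm : F.card + m = G.card) : coneSum x F * coneSum x G ^ m = coneSum x G ^ (m + 1) := by
  induction m generalizing G with
  | zero => rw [eq_of_subset_of_card_le h (by omega)]; simp
  | succ m ih =>
    obtain ⟨i, hi, hiF⟩ := exists_of_ssubset (h.ssubset_of_ne fun e => by subst e; omega)
    have h1 := ih (G := G.erase i)
      (fun j hj => mem_erase.2 ⟨fun e => hiF (e ▸ hj), h hj⟩) (by rw [card_erase_of_mem hi]; omega)
    rw [← insert_erase hi, r.coneSum_insert_pow, r.coneSum_insert_pow, ← h1]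
    ring

/-- A set with at least `d` elements has the same class as any of its subsets with exactly `d`
elements. -/
theorem coneSum_pow_min (r : AugChowRelations d x y) (G : Finset α) :
    coneSum x G ^ (min G.card d + 1) = 0 := by
  rcases le_total G.card d with h | h
  · rw [min_eq_left h, r.coneSum_pow]
  · obtain ⟨G', -, hG'⟩ := exists_subset_card_eq h
    rw [min_eq_right h, r.coneSum_large h, ← r.coneSum_large hG'.ge]
    have := r.coneSum_pow G'
    rwa [hG'] at this

theorem coneSum_mul_pow_min (r : AugChowRelations d x y) (F G : Finset α) (hFG : F ⊂ G)
    (hF : F.card < d) : coneSum x F * coneSum x G ^ (min G.card d - F.card) =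
      coneSum x G ^ (min G.card d - F.card + 1) := by
  have h1 := card_lt_card hFG
  rcases le_total G.card d with h | h
  · rw [min_eq_left h, r.coneSum_mul_pow hFG.1 (by omega)]
  · obtain ⟨G', hFG', -, hG'⟩ := exists_subsuperset_card_eq hFG.1 hF.le h
    rw [min_eq_right h, r.coneSum_large h, ← r.coneSum_large hG'.ge,
      r.coneSum_mul_pow hFG' (by omega)]

theorem prod_coneSum_mem_span [Algebra ℚ C] (r : AugChowRelations d x y)
    (τ : Multiset (Finset α)) :
    (τ.map (coneSum x)).prod ∈ Submodule.span ℚ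
      {p | ∃ σ, IsStandard d σ ∧ σ.card = τ.card ∧ p = (σ.map (coneSum x)).prod} :=
  prod_mem_span_isStandard (coneSum_empty x) (fun _ hA => r.coneSum_large hA) r.coneSum_union
    r.coneSum_pow_min r.coneSum_mul_pow_min τ

theorem mem_span_range_coneSum [Algebra ℚ C] (r : AugChowRelations d x y)
    (hd : d ≤ Fintype.card α) (F : Finset α) :
    x F ∈ Submodule.span ℚ (Set.range (coneSum x)) := by
  by_cases hF : F = univ
  · rw [r.large F (by rwa [hF, card_univ])]; exact zero_mem _
  rw [← moebiusSum_coneSum x hF, moebiusSum]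
  exact neg_mem (sum_mem fun B _ => zsmul_mem (Submodule.subset_span (Set.mem_range_self B)) _)

/-- A product of `k` linear combinations of the `coneSum x A` is a linear combination of standard
products. -/
theorem prod_mem_span_isStandard_of_linear [Algebra ℚ C] (r : AugChowRelations d x y)
    (s : Multiset C) (hs : ∀ p ∈ s, p ∈ Submodule.span ℚ (Set.range (coneSum x))) :
    s.prod ∈ Submodule.span ℚ
      {p | ∃ σ, IsStandard d σ ∧ σ.card = s.card ∧ p = (σ.map (coneSum x)).prod} := by
  have key : s.prod ∈ Submodule.span ℚ
      {p | ∃ τ : Multiset (Finset α), τ.card = s.card ∧ p = (τ.map (coneSum x)).prod} := by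
    induction s using Multiset.induction_on with
    | empty =>
      refine Submodule.subset_span ?_
      exact ⟨0, by simp, by simp⟩
    | cons p s ih =>
      have h1 := Submodule.mul_mem_mul (hs p (Multiset.mem_cons_self _ _))
        (ih fun q hq => hs q (Multiset.mem_cons_of_mem hq))
      rw [Submodule.span_mul_span] at h1
      rw [Multiset.prod_cons]
      refine Submodule.span_mono ?_ h1
      rintro _ ⟨_, ⟨A, rfl⟩, _, ⟨τ, hτ, rfl⟩, rfl⟩
      exact ⟨A ::ₘ τ, by simp [hτ], by simp⟩
  refine Submodule.span_le.2 ?_ key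
  rintro _ ⟨τ, hτ, rfl⟩
  rw [← hτ]
  exact r.prod_coneSum_mem_span τ

end AugChowRelations

end Relations

/-! ### Linear independence of the standard monomials -/

section Independence

open MvPolynomial

variable {α : Type*} [DecidableEq α] [Fintype α]

/-- Every standard monomial has a dual element with respect to `hallForm d`, up to a triangular
matrix. -/
theorem IsStandard.exists_dual {d : ℕ} (hd : d ≤ Fintype.card α) {τ : Multiset (Finset α)}
    (hτ : IsStandard d τ) :
    ∃ p, hallForm d ((τ.map X).prod * p) ≠ 0 ∧
      ∀ s : Multiset (Finset α), s.card = τ.card → hallForm d ((s.map X).prod * p) ≠ 0 →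
        Dominates univ τ s := by
  have hfil : ∀ s : Multiset (Finset α), s.filter (· ⊆ univ) = s := fun s =>
    Multiset.filter_eq_self.2 fun A _ => subset_univ A
  rcases hτ with rfl | ⟨G, τ, a, hG, ha, rfl⟩
  · refine ⟨1, ?_, fun s hs _ => dominates_replicate ?_⟩
    · rw [mul_one, hallForm_prod, hallIndicator_replicate (by rwa [card_univ])]
      exact one_ne_zero
    · rw [hfil, hs, Multiset.card_replicate]
  · obtain ⟨ν, c, hc⟩ := hG.exists_dualChain
    have hGu : G ⊂ univ := by
      rw [ssubset_univ_iff]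
      rintro rfl
      rw [card_univ] at ha
      omega
    -- Of the copies of `univ` needed to reach degree `d`, `a` belong to the standard monomial and
    -- `b` to its dual.
    obtain ⟨b, hb⟩ : ∃ b, G.card + 1 + (a + b) = d := ⟨d - G.card - 1 - a, by omega⟩
    refine ⟨(c.map (moebiusSum X univ)).prod * ((ν + Multiset.replicate b univ).map X).prod,
      ?_, fun s hs h => ?_⟩
    · have h1 := hc.hallForm_eq_one hGu (e := a + b) (by rw [card_univ]; omega)
      rw [hb] at h1
      refine ne_of_eq_of_ne ?_ one_ne_zero
      rw [← h1]
      congr 1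
      simp only [Multiset.map_add, Multiset.prod_add, Multiset.map_replicate,
        Multiset.prod_replicate]
      ring
    · have h1 : Dominates G τ s := by
        refine hc.dominates hGu (pre := 0) (ρ := Multiset.replicate b univ) (by simp) ?_
          (fun H _ => subset_univ H) (fun H _ => subset_univ H) (D := d) ?_
        · intro H hH
          rw [Multiset.eq_of_mem_replicate hH]
          exact hGu.2
        · convert h using 2
          rw [zero_add, Multiset.map_add _ _ s, Multiset.prod_add]
          ring
      refine h1.step hGu hG.subset_of_mem ?_
      rw [hfil, hs, Multiset.card_add, Multiset.card_replicate]

theorem Dominates.eq_of_le {τ s : Multiset (Finset α)} (h : Dominates univ τ s)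
    (hc : s.card = τ.card)
    (hle : (s.map fun A => Fintype.card α - A.card).sum ≤
      (τ.map fun A => Fintype.card α - A.card).sum) : s = τ := by
  have hfil : s.filter (· ⊆ univ) = s :=
    Multiset.filter_eq_self.2 fun A _ => subset_univ A
  obtain ⟨-, h2, h3⟩ := h
  rw [hfil, card_univ] at h2 h3
  obtain ⟨k, hk⟩ := h3 (le_antisymm h2 hle)
  have : k = 0 := by
    rw [hk, Multiset.card_add, Multiset.card_replicate] at hc
    omega
  rw [hk, this, Multiset.replicate_zero, add_zero]

/-- The standard monomials of a fixed degree are linearly independent modulo `hallIdeal`. -/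
theorem linearIndependent_mk_hallIdeal {d k : ℕ} (hd : d ≤ Fintype.card α) :
    LinearIndependent ℚ fun τ : {τ : Multiset (Finset α) // IsStandard d τ ∧ τ.card = k} =>
      Ideal.Quotient.mk (hallIdeal α d) (τ.1.map X).prod := by
  classical
  rw [linearIndependent_iff']
  intro S g hg
  by_contra hne
  push Not at hne
  obtain ⟨τ₀, hτ₀, hg₀⟩ := hne
  -- Only multisets of at least the weight of `τ` pair non-trivially with its dual, so in a relation
  -- the term of maximal weight is isolated.
  obtain ⟨τ, hτ, hmax⟩ := exists_max_image (S.filter fun τ => g τ ≠ 0)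
    (fun τ => (τ.1.map fun A => Fintype.card α - A.card).sum)
    ⟨τ₀, mem_filter.2 ⟨hτ₀, hg₀⟩⟩
  rw [mem_filter] at hτ
  obtain ⟨p, hp, hdom⟩ := τ.2.1.exists_dual hd
  have h1 : ∑ σ ∈ S, g σ • (σ.1.map X).prod ∈ hallIdeal α d := by
    rw [← Ideal.Quotient.eq_zero_iff_mem, map_sum, ← hg]
    exact sum_congr rfl fun σ _ => rfl
  have h2 := h1 p
  rw [sum_mul, map_sum, sum_eq_single τ] at h2
  · rw [smul_mul_assoc, map_smul, smul_eq_mul, mul_eq_zero] at h2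
    exact h2.elim hτ.2 hp
  · intro σ hσ hne
    rw [smul_mul_assoc, map_smul, smul_eq_mul, mul_eq_zero]
    by_contra hcon
    push Not at hcon
    have hc : σ.1.card = τ.1.card := by rw [σ.2.2, τ.2.2]
    exact hne (Subtype.ext ((hdom σ.1 hc hcon.2).eq_of_le hc
      (hmax σ (mem_filter.2 ⟨hσ, hcon.1⟩))))
  · exact fun h => absurd hτ.1 h

end Independence

/-! ### Proper flats of the uniform matroid -/

section Uniform

open Matroid

theorem uniformMatroid_ground (d n : ℕ) : (uniformMatroid d n).E = Set.univ := rfl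

theorem uniformMatroid_indep_iff {d n : ℕ} {I : Set (Fin n)} :
    (uniformMatroid d n).Indep I ↔ I.ncard ≤ d := by
  simp [uniformMatroid]

theorem uniformMatroid_isFlat_iff {d n : ℕ} (hd : d ≤ n) {F : Set (Fin n)} :
    ((uniformMatroid d n).IsFlat F ∧ F ≠ (uniformMatroid d n).E) ↔ F.ncard < d := by
  rw [uniformMatroid_ground]
  constructor
  · rintro ⟨hF, hne⟩
    by_contra hlt
    -- A `d`-element subset of `F` is a basis of every set containing it, so a flat with at least
    -- `d` elements is everything.
    obtain ⟨I, hIF, hI⟩ := Set.exists_subset_card_eq (s := F) (n := d) (by omega)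
    have hb : ∀ X, I ⊆ X → (uniformMatroid d n).IsBasis I X := by
      intro X hIX
      rw [isBasis_iff (Set.subset_univ _)]
      refine ⟨uniformMatroid_indep_iff.2 hI.le, hIX, fun J hJ hIJ _ => ?_⟩
      rw [uniformMatroid_indep_iff] at hJ
      exact Set.eq_of_subset_of_ncard_le hIJ (by omega) (Set.toFinite J)
    exact hne (Set.eq_univ_of_univ_subset
      (hF.subset_of_isBasis_of_isBasis (hb F hIF) (hb Set.univ (Set.subset_univ _))))
  · intro h
    refine ⟨⟨fun I X hIF hIX => ?_, Set.subset_univ _⟩, ?_⟩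
    · have hFi : (uniformMatroid d n).Indep F := uniformMatroid_indep_iff.2 h.le
      have hIeq : I = F := hIF.eq_of_subset_indep hFi hIF.subset subset_rfl
      subst hIeq
      intro a ha
      by_contra haI
      have h2 : (uniformMatroid d n).Indep (insert a I) := by
        rw [uniformMatroid_indep_iff, Set.ncard_insert_of_notMem haI]
        omega
      have h3 := hIX.eq_of_subset_indep h2 (Set.subset_insert _ _)
        (Set.insert_subset ha hIX.subset)
      exact haI (h3 ▸ Set.mem_insert a I)
    · rintro rfl
      rw [Set.ncard_univ, Nat.card_fin] at h
      omega

end Uniform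

/-! ### The monomial basis of the augmented Chow ring -/

section UniformChow

open Matroid

variable {d n : ℕ}

/-- The proper flat given by a set with less than `d` elements. -/
def flatOfFinset (hd : d ≤ n) (F : Finset (Fin n)) (hF : F.card < d) :
    (uniformMatroid d n).ProperFlat :=
  ⟨F, (uniformMatroid_isFlat_iff hd).2 (by rwa [Set.ncard_coe_finset])⟩

/-- The finite set underlying a proper flat. -/
noncomputable def finsetOfFlat (F : (uniformMatroid d n).ProperFlat) : Finset (Fin n) :=
  (Set.toFinite F.1).toFinset

theorem coe_finsetOfFlat (F : (uniformMatroid d n).ProperFlat) :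
    (finsetOfFlat F : Set (Fin n)) = F.1 := Set.Finite.coe_toFinset _

theorem card_finsetOfFlat (hd : d ≤ n) (F : (uniformMatroid d n).ProperFlat) :
    (finsetOfFlat F).card < d := by
  rw [← Set.ncard_coe_finset, coe_finsetOfFlat]
  exact (uniformMatroid_isFlat_iff hd).1 F.2

theorem flatOfFinset_finsetOfFlat (hd : d ≤ n) (F : (uniformMatroid d n).ProperFlat) :
    flatOfFinset hd (finsetOfFlat F) (card_finsetOfFlat hd F) = F :=
  Subtype.ext (coe_finsetOfFlat F)

theorem finsetOfFlat_flatOfFinset (hd : d ≤ n) (F : Finset (Fin n)) (hF : F.card < d) :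
    finsetOfFlat (flatOfFinset hd F hF) = F :=
  coe_injective (coe_finsetOfFlat _)

theorem finsetOfFlat_injective :
    Function.Injective (finsetOfFlat : (uniformMatroid d n).ProperFlat → _) := by
  intro F G h
  exact Subtype.ext (by rw [← coe_finsetOfFlat, h, coe_finsetOfFlat])

theorem sum_flats_eq_sum_finsets (hd : d ≤ n) {A : Type*} [AddCommMonoid A]
    (f : (uniformMatroid d n).ProperFlat → A) (i : Fin n) :
    ∑ F ∈ (Set.toFinite {F : (uniformMatroid d n).ProperFlat | i ∉ F.1}).toFinset, f F =
      ∑ F with i ∉ F, if hF : F.card < d then f (flatOfFinset hd F hF) else 0 := by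
  refine sum_of_injOn finsetOfFlat finsetOfFlat_injective.injOn ?_ ?_ ?_
  · intro F hF
    rw [mem_coe, Set.Finite.mem_toFinset] at hF
    refine mem_coe.2 (mem_filter.2 ⟨mem_univ _, fun h => hF ?_⟩)
    rwa [← coe_finsetOfFlat, mem_coe]
  · intro F hF hF'
    rw [mem_filter] at hF
    refine dif_neg fun hc => hF' ⟨flatOfFinset hd F hc, ?_, finsetOfFlat_flatOfFinset hd F hc⟩
    rw [mem_coe, Set.Finite.mem_toFinset]
    exact fun h => hF.2 (mem_coe.1 h)
  · intro F _
    rw [dif_pos (card_finsetOfFlat hd F), flatOfFinset_finsetOfFlat]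

/-- The variable of a set with less than `d` elements, and zero for larger sets. -/
noncomputable def flatVar (hd : d ≤ n) (F : Finset (Fin n)) :
    MvPolynomial (uniformMatroid d n).AugVertex ℚ :=
  if hF : F.card < d then MvPolynomial.X (Sum.inr (flatOfFinset hd F hF)) else 0

/-- The variable of an element of the ground set. -/
noncomputable def elementVar (d : ℕ) (i : Fin n) :
    MvPolynomial (uniformMatroid d n).AugVertex ℚ :=
  MvPolynomial.X (Sum.inl ⟨i, Set.mem_univ i⟩)

theorem augChowRelations_uniform (hd : d ≤ n) :
    AugChowRelations d
      (fun F => Ideal.Quotient.mk (uniformMatroid d n).augmentedChowIdeal (flatVar hd F))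
      (fun i => Ideal.Quotient.mk (uniformMatroid d n).augmentedChowIdeal (elementVar d i)) where
  large F hF := by rw [flatVar, dif_neg (by omega), map_zero]
  linear i := by
    rw [← map_sum, Ideal.Quotient.eq]
    refine Ideal.subset_span (Or.inl (Or.inl ⟨⟨i, Set.mem_univ i⟩, ?_⟩))
    rw [sum_flats_eq_sum_finsets hd]
    rfl
  incomparable F G hFG hGF := by
    rw [← map_mul, Ideal.Quotient.eq_zero_iff_mem, flatVar, flatVar]
    split_ifs with h1 h2
    · exact Ideal.subset_span (Or.inl (Or.inr ⟨flatOfFinset hd F h1, flatOfFinset hd G h2,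
        fun h => hFG (coe_subset.1 h), fun h => hGF (coe_subset.1 h), rfl⟩))
    all_goals simp
  mul_eq_zero i F hi := by
    rw [← map_mul, Ideal.Quotient.eq_zero_iff_mem, flatVar]
    split_ifs with h1
    · exact Ideal.subset_span (Or.inr ⟨⟨i, Set.mem_univ i⟩, flatOfFinset hd F h1,
        fun h => hi (mem_coe.1 h), rfl⟩)
    · simp

/-- The homomorphism from the polynomial ring of the augmented Chow ring to the ring of
`hallForm`. -/
noncomputable def toHallRing (d n : ℕ) : MvPolynomial (uniformMatroid d n).AugVertex ℚ →ₐ[ℚ]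
    MvPolynomial (Finset (Fin n)) ℚ :=
  MvPolynomial.aeval (Sum.elim (fun i => MvPolynomial.X {i.1})
    fun F => moebiusSum MvPolynomial.X univ (finsetOfFlat F))

theorem toHallRing_elementVar (i : Fin n) :
    toHallRing d n (elementVar d i) = MvPolynomial.X {i} := by
  simp [toHallRing, elementVar]

/-- Extending the variables by zero to large sets is compatible with the alternating sums, except at
`univ`, where the sum is `-X univ` and need not vanish. -/
theorem mk_toHallRing_flatVar (hd : d ≤ n) {F : Finset (Fin n)} (hF : F ≠ univ) :
    Ideal.Quotient.mk (hallIdeal (Fin n) d) (toHallRing d n (flatVar hd F)) =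
      Ideal.Quotient.mk (hallIdeal (Fin n) d) (moebiusSum MvPolynomial.X univ F) := by
  rw [flatVar]
  split_ifs with h
  · rw [toHallRing, MvPolynomial.aeval_X, Sum.elim_inr, finsetOfFlat_flatOfFinset]
  · rw [map_zero, map_zero, eq_comm, Ideal.Quotient.eq_zero_iff_mem]
    exact moebiusSum_mem_hallIdeal (by omega) hF

theorem mk_toHallRing_coneSum (hd : d ≤ n) (A : Finset (Fin n)) :
    Ideal.Quotient.mk (hallIdeal (Fin n) d) (toHallRing d n (coneSum (flatVar hd) A)) =
      Ideal.Quotient.mk (hallIdeal (Fin n) d) (MvPolynomial.X A) := by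
  have h0 : Ideal.Quotient.mk (hallIdeal (Fin n) d) (MvPolynomial.X ∅) = 0 :=
    Ideal.Quotient.eq_zero_iff_mem.2 (X_empty_mem_hallIdeal d)
  rw [coneSum, map_sum, map_sum, sum_congr rfl fun F hF => mk_toHallRing_flatVar hd (F := F) ?_,
    ← map_sum, sum_moebiusSum, map_sub, h0, sub_zero]
  rintro rfl
  exact (mem_filter.1 hF).2 (subset_univ A)

theorem augmentedChowIdeal_le_comap (hd : d ≤ n) :
    (uniformMatroid d n).augmentedChowIdeal ≤ (hallIdeal (Fin n) d).comap (toHallRing d n) := by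
  refine Ideal.span_le.2 ?_
  rintro p ((⟨i, rfl⟩ | ⟨F, G, hFG, hGF, rfl⟩) | ⟨i, F, hi, rfl⟩)
  · have h1 := mk_toHallRing_coneSum hd {i.1}
    rw [SetLike.mem_coe, Ideal.mem_comap, map_sub, ← Ideal.Quotient.eq, sum_flats_eq_sum_finsets hd]
    rw [coneSum] at h1
    simp only [singleton_subset_iff] at h1
    exact (congrArg _ (toHallRing_elementVar i.1)).trans h1.symm
  · rw [SetLike.mem_coe, Ideal.mem_comap, map_mul, toHallRing, MvPolynomial.aeval_X,
      MvPolynomial.aeval_X]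
    refine moebiusSum_mul_moebiusSum_mem_hallIdeal d (fun h => hFG ?_) fun h => hGF ?_
    · rwa [← coe_finsetOfFlat, ← coe_finsetOfFlat, coe_subset]
    · rwa [← coe_finsetOfFlat, ← coe_finsetOfFlat, coe_subset]
  · rw [SetLike.mem_coe, Ideal.mem_comap, map_mul, toHallRing, MvPolynomial.aeval_X,
      MvPolynomial.aeval_X]
    refine X_singleton_mul_moebiusSum_mem_hallIdeal d fun h => hi ?_
    rwa [← coe_finsetOfFlat, mem_coe]

/-- The product of the classes `coneSum A` in the augmented Chow ring. -/
noncomputable def coneMonomial (hd : d ≤ n) (τ : Multiset (Finset (Fin n))) :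
    (uniformMatroid d n).AugmentedChowRing :=
  (τ.map (coneSum fun F =>
    Ideal.Quotient.mk (uniformMatroid d n).augmentedChowIdeal (flatVar hd F))).prod

theorem coneMonomial_eq_mk (hd : d ≤ n) (τ : Multiset (Finset (Fin n))) :
    coneMonomial hd τ = Ideal.Quotient.mk (uniformMatroid d n).augmentedChowIdeal
      (τ.map (coneSum (flatVar hd))).prod := by
  rw [coneMonomial, map_multiset_prod, Multiset.map_map]
  congr 1
  refine Multiset.map_congr rfl fun A _ => ?_
  simp only [coneSum, Function.comp_apply, map_sum]

/-- The map to the ring modulo `hallIdeal` sends each h_A to the variable of `A`, and independence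
is known there. -/
theorem linearIndependent_coneMonomial (hd : d ≤ n) (k : ℕ) :
    LinearIndependent ℚ
      fun τ : {τ : Multiset (Finset (Fin n)) // IsStandard d τ ∧ τ.card = k} =>
        coneMonomial hd τ.1 := by
  have h1 := linearIndependent_mk_hallIdeal (α := Fin n) (d := d) (k := k) (by simpa using hd)
  refine LinearIndependent.of_comp
    (Ideal.quotientMapₐ (hallIdeal (Fin n) d) (toHallRing d n)
      (augmentedChowIdeal_le_comap hd)).toLinearMap ?_
  have h2 : (Ideal.quotientMapₐ (hallIdeal (Fin n) d) (toHallRing d n)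
      (augmentedChowIdeal_le_comap hd)).toLinearMap ∘
      (fun τ : {τ : Multiset (Finset (Fin n)) // IsStandard d τ ∧ τ.card = k} =>
        coneMonomial hd τ.1) =
      fun τ => Ideal.Quotient.mk (hallIdeal (Fin n) d) (τ.1.map MvPolynomial.X).prod := by
    funext τ
    rw [Function.comp_apply, coneMonomial_eq_mk, AlgHom.toLinearMap_apply]
    refine (Ideal.quotient_map_mkₐ _ _ _).trans ?_
    rw [Ideal.Quotient.mkₐ_eq_mk, map_multiset_prod, map_multiset_prod, map_multiset_prod,
      Multiset.map_map, Multiset.map_map, Multiset.map_map]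
    congr 1
    exact Multiset.map_congr rfl fun A _ => mk_toHallRing_coneSum hd A
  rw [h2]
  exact h1

theorem isHomogeneous_coneSum_flatVar (hd : d ≤ n) (A : Finset (Fin n)) :
    (coneSum (flatVar hd) A).IsHomogeneous 1 := by
  refine MvPolynomial.IsHomogeneous.sum _ _ _ fun F _ => ?_
  rw [flatVar]
  split_ifs
  · exact MvPolynomial.isHomogeneous_X _ _
  · exact MvPolynomial.isHomogeneous_zero _ _ _

theorem coneMonomial_mem_augmentedChowPiece (hd : d ≤ n) (τ : Multiset (Finset (Fin n))) :
    coneMonomial hd τ ∈ (uniformMatroid d n).augmentedChowPiece τ.card := by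
  rw [coneMonomial_eq_mk]
  refine Submodule.mem_map.2 ⟨_, ?_, rfl⟩
  rw [MvPolynomial.mem_homogeneousSubmodule]
  induction τ using Multiset.induction_on with
  | empty => simpa using MvPolynomial.isHomogeneous_one _ _
  | cons A τ ih =>
    rw [Multiset.map_cons, Multiset.prod_cons, Multiset.card_cons, add_comm]
    exact (isHomogeneous_coneSum_flatVar hd A).mul ih

theorem augmentedChowPiece_eq_span (hd : d ≤ n) (k : ℕ) :
    (uniformMatroid d n).augmentedChowPiece k = Submodule.span ℚ (Set.range
      fun τ : {τ : Multiset (Finset (Fin n)) // IsStandard d τ ∧ τ.card = k} =>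
        coneMonomial hd τ.1) := by
  classical
  refine le_antisymm ?_ (Submodule.span_le.2 ?_)
  · rintro _ ⟨p, hp, rfl⟩
    rw [SetLike.mem_coe, MvPolynomial.mem_homogeneousSubmodule] at hp
    rw [MvPolynomial.as_sum p, map_sum]
    refine sum_mem fun e he => ?_
    have hr := augChowRelations_uniform hd
    have h1 : MvPolynomial.monomial e (p.coeff e) = p.coeff e •
        ((Finsupp.toMultiset e).map MvPolynomial.X).prod := by
      rw [prod_map_X_eq_monomial, Finsupp.toMultiset_toFinsupp, MvPolynomial.smul_monomial,
        smul_eq_mul, mul_one]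
    rw [h1, map_smul]
    refine Submodule.smul_mem _ _ ?_
    have hdeg : (Finsupp.toMultiset e).card = k := by
      have h2 : e.degree = k := by
        rw [Finsupp.degree_eq_weight_one]
        exact hp (MvPolynomial.mem_support_iff.1 he)
      rw [Finsupp.card_toMultiset]
      exact h2
    have h2 := hr.prod_mem_span_isStandard_of_linear
      (((Finsupp.toMultiset e).map MvPolynomial.X).map
        (Ideal.Quotient.mk (uniformMatroid d n).augmentedChowIdeal)) ?_
    · rw [AlgHom.toLinearMap_apply, Ideal.Quotient.mkₐ_eq_mk, map_multiset_prod]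
      refine Submodule.span_mono ?_ h2
      rintro _ ⟨σ, hσ, hc, rfl⟩
      rw [Multiset.card_map, Multiset.card_map, hdeg] at hc
      exact ⟨⟨σ, hσ, hc⟩, rfl⟩
    · intro q hq
      rw [Multiset.map_map, Multiset.mem_map] at hq
      obtain ⟨v, -, rfl⟩ := hq
      rcases v with i | F
      · rw [Function.comp_apply]
        exact Submodule.subset_span ⟨{i.1}, hr.coneSum_singleton i.1⟩
      · have h3 := hr.mem_span_range_coneSum (by simpa using hd) (finsetOfFlat F)
        rw [flatVar, dif_pos (card_finsetOfFlat hd F), flatOfFinset_finsetOfFlat] at h3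
        exact h3
  · rintro _ ⟨τ, rfl⟩
    have := coneMonomial_mem_augmentedChowPiece hd τ.1
    rwa [τ.2.2] at this

theorem finrank_augmentedChowPiece (hd : d ≤ n) (k : ℕ) :
    Module.finrank ℚ ((uniformMatroid d n).augmentedChowPiece k) =
      Nat.card {τ : Multiset (Finset (Fin n)) // IsStandard d τ ∧ τ.card = k} := by
  have : Finite {τ : Multiset (Finset (Fin n)) // IsStandard d τ ∧ τ.card = k} := by
    refine Finite.of_injective (β := Sym (Finset (Fin n)) k) (fun τ => ⟨τ.1, τ.2.2⟩) ?_
    intro σ τ h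
    have h' := congrArg (fun s : Sym (Finset (Fin n)) k => s.1) h
    exact Subtype.ext h'
  have := Fintype.ofFinite {τ : Multiset (Finset (Fin n)) // IsStandard d τ ∧ τ.card = k}
  rw [augmentedChowPiece_eq_span hd, finrank_span_eq_card (linearIndependent_coneMonomial hd k),
    Nat.card_eq_fintype_card]

end UniformChow

/-! ### Generating polynomials of nested and standard multisets -/

section Counting

variable {α : Type*} [DecidableEq α]

theorem IsNested.sup_eq {G : Finset α} {τ : Multiset (Finset α)} (h : IsNested G τ) :
    τ.sup = G := by
  refine le_antisymm (Multiset.sup_le.2 h.subset_of_mem) ?_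
  cases h with
  | start G =>
    rcases G.eq_empty_or_nonempty with rfl | hG
    · exact bot_le
    · exact Multiset.le_sup (Multiset.mem_replicate.2 ⟨hG.card_pos.ne', rfl⟩)
  | step h hG ha hab =>
    exact Multiset.le_sup (Multiset.mem_add.2 (Or.inr (Multiset.mem_replicate.2 ⟨ha.ne', rfl⟩)))

theorem IsNested.card_le {G : Finset α} {τ : Multiset (Finset α)} (h : IsNested G τ) :
    τ.card ≤ G.card := by
  induction h with
  | start G => simp
  | step h hG ha hab ih => rw [Multiset.card_add, Multiset.card_replicate]; omega

theorem IsNested.count_eq_zero {G T : Finset α} {τ : Multiset (Finset α)} (h : IsNested G τ)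
    (hT : G ⊂ T) : τ.count T = 0 :=
  Multiset.count_eq_zero_of_notMem fun hm => hT.2 (h.subset_of_mem T hm)

/-- The multiplicity of `T` recovers the number of added copies, and the supremum of the rest
recovers the largest member. -/
theorem IsNested.add_replicate_inj {G₁ G₂ T : Finset α} {τ₁ τ₂ : Multiset (Finset α)} {a₁ a₂ : ℕ}
    (h₁ : IsNested G₁ τ₁) (h₂ : IsNested G₂ τ₂) (hT₁ : G₁ ⊂ T) (hT₂ : G₂ ⊂ T)
    (h : τ₁ + Multiset.replicate a₁ T = τ₂ + Multiset.replicate a₂ T) :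
    G₁ = G₂ ∧ a₁ = a₂ ∧ τ₁ = τ₂ := by
  have ha := congrArg (Multiset.count T) h
  rw [Multiset.count_add, Multiset.count_add, h₁.count_eq_zero hT₁, h₂.count_eq_zero hT₂,
    Multiset.count_replicate_self, Multiset.count_replicate_self, zero_add, zero_add] at ha
  subst ha
  have hτ := add_right_cancel h
  subst hτ
  exact ⟨h₁.sup_eq.symm.trans h₂.sup_eq, rfl, rfl⟩

theorem finite_multiset_card_le {β : Type*} [Finite β] (m : ℕ) :
    {s : Multiset β | s.card ≤ m}.Finite := by
  have : {s : Multiset β | s.card ≤ m} ⊆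
      ⋃ k ∈ Set.Iic m, Set.range (fun s : Sym β k => (s : Multiset β)) := by
    intro s hs
    exact Set.mem_biUnion (x := s.card) hs ⟨⟨s, rfl⟩, rfl⟩
  exact ((Set.finite_Iic m).biUnion fun k _ => Set.finite_range _).subset this

variable [Fintype α]

theorem finite_isNested (G : Finset α) : {τ | IsNested G τ}.Finite :=
  (finite_multiset_card_le G.card).subset fun _ h => h.card_le

/-- The finite set of all nested multisets with largest member `G`. -/
noncomputable def nestedFinset (G : Finset α) : Finset (Multiset (Finset α)) :=
  (finite_isNested G).toFinset

theorem mem_nestedFinset {G : Finset α} {τ : Multiset (Finset α)} :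
    τ ∈ nestedFinset G ↔ IsNested G τ := Set.Finite.mem_toFinset _

open Polynomial

/-- A sum over multisets with members of a fixed multiplicity added at the top. -/
theorem sum_image_add_replicate {T : Finset α} (P : Finset (Finset α)) (hP : ∀ G ∈ P, G ⊂ T)
    (I : Finset α → Finset ℕ) :
    ∑ τ ∈ (P.sigma fun G => I G ×ˢ nestedFinset G).image
        (fun q => q.2.2 + Multiset.replicate q.2.1 T), (X : ℤ[X]) ^ τ.card =
      ∑ G ∈ P, (∑ a ∈ I G, X ^ a) * ∑ τ ∈ nestedFinset G, X ^ τ.card := by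
  rw [sum_image, sum_sigma]
  · refine sum_congr rfl fun G _ => ?_
    rw [sum_product, sum_mul_sum]
    refine sum_congr rfl fun a _ => sum_congr rfl fun τ _ => ?_
    rw [Multiset.card_add, Multiset.card_replicate, pow_add, mul_comm]
  · rintro ⟨G₁, a₁, τ₁⟩ h₁ ⟨G₂, a₂, τ₂⟩ h₂ h
    simp only [mem_coe, mem_sigma, mem_product, mem_nestedFinset] at h₁ h₂
    obtain ⟨rfl, rfl, rfl⟩ := h₁.2.2.add_replicate_inj h₂.2.2 (hP _ h₁.1) (hP _ h₂.1) h
    rfl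

/-- The two cases come from the two constructors of `IsNested`; they are disjoint because only the
first gives `G` its full multiplicity |G|, or is empty when `G` is. -/
theorem sum_nestedFinset (G : Finset α) :
    ∑ τ ∈ nestedFinset G, (X : ℤ[X]) ^ τ.card = X ^ G.card +
      ∑ G' ∈ G.ssubsets, (∑ a ∈ Ico 1 (G.card - G'.card), X ^ a) *
        ∑ τ ∈ nestedFinset G', X ^ τ.card := by
  rw [← sum_image_add_replicate G.ssubsets (fun G' h => mem_ssubsets.1 h)
    fun G' => Ico 1 (G.card - G'.card)]
  have h1 : nestedFinset G = insert (Multiset.replicate G.card G)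
      ((G.ssubsets.sigma fun G' => Ico 1 (G.card - G'.card) ×ˢ nestedFinset G').image
        fun q => q.2.2 + Multiset.replicate q.2.1 G) := by
    ext τ
    rw [mem_nestedFinset, mem_insert, mem_image]
    constructor
    · intro h
      cases h with
      | start G => exact Or.inl rfl
      | @step G' G τ a h hG ha hab =>
        refine Or.inr ⟨⟨G', a, τ⟩, ?_, rfl⟩
        simp only [mem_sigma, mem_ssubsets, mem_product, mem_Ico, mem_nestedFinset]
        exact ⟨hG, ⟨ha, by omega⟩, h⟩
    · rintro (rfl | ⟨⟨G', a, τ⟩, h, rfl⟩)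
      · exact IsNested.start G
      · simp only [mem_sigma, mem_ssubsets, mem_product, mem_Ico, mem_nestedFinset] at h
        have h3 : a < G.card - G'.card := h.2.1.2
        exact h.2.2.step h.1 h.2.1.1 (show G'.card + a < G.card by omega)
  rw [h1, sum_insert, Multiset.card_replicate]
  rw [mem_image]
  rintro ⟨⟨G', a, τ⟩, h, h'⟩
  simp only [mem_sigma, mem_ssubsets, mem_product, mem_Ico, mem_nestedFinset] at h
  change τ + Multiset.replicate a G = _ at h'
  have := congrArg (Multiset.count G) h'
  rw [Multiset.count_add, h.2.2.count_eq_zero h.1, Multiset.count_replicate_self,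
    Multiset.count_replicate_self] at this
  omega

theorem finite_isStandard (d : ℕ) : {τ : Multiset (Finset α) | IsStandard d τ}.Finite := by
  refine (finite_multiset_card_le d).subset ?_
  rintro _ (rfl | ⟨G, τ, a, h, ha, rfl⟩)
  · simp
  · have := h.card_le
    simp only [Set.mem_ofPred_eq, Multiset.card_add, Multiset.card_replicate]
    omega

/-- The finite set of all standard multisets. -/
noncomputable def standardFinset (α : Type*) [DecidableEq α] [Fintype α] (d : ℕ) :
    Finset (Multiset (Finset α)) :=
  (finite_isStandard (α := α) d).toFinset

theorem mem_standardFinset {d : ℕ} {τ : Multiset (Finset α)} :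
    τ ∈ standardFinset α d ↔ IsStandard d τ := Set.Finite.mem_toFinset _

theorem sum_standardFinset {d : ℕ} (hd : d ≤ Fintype.card α) :
    ∑ τ ∈ standardFinset α d, (X : ℤ[X]) ^ τ.card = X ^ d +
      ∑ G : Finset α with G.card < d, (∑ a ∈ range (d - G.card), X ^ a) *
        ∑ τ ∈ nestedFinset G, X ^ τ.card := by
  have hP : ∀ G ∈ univ.filter (fun G : Finset α => G.card < d), G ⊂ univ := by
    intro G hG
    rw [ssubset_univ_iff]
    rintro rfl
    rw [mem_filter, card_univ] at hG
    omega
  rw [← sum_image_add_replicate _ hP fun G => range (d - G.card)]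
  have h1 : standardFinset α d = insert (Multiset.replicate d univ)
      (((univ.filter fun G : Finset α => G.card < d).sigma
        fun G => range (d - G.card) ×ˢ nestedFinset G).image
        fun q => q.2.2 + Multiset.replicate q.2.1 univ) := by
    ext τ
    rw [mem_standardFinset, mem_insert, mem_image]
    constructor
    · rintro (rfl | ⟨G, τ, a, h, ha, rfl⟩)
      · exact Or.inl rfl
      · refine Or.inr ⟨⟨G, a, τ⟩, ?_, rfl⟩
        simp only [mem_sigma, mem_filter, mem_univ, true_and, mem_product, mem_range,
          mem_nestedFinset]
        exact ⟨by omega, by omega, h⟩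
    · rintro (rfl | ⟨⟨G, a, τ⟩, h, rfl⟩)
      · exact Or.inl rfl
      · simp only [mem_sigma, mem_filter, mem_univ, true_and, mem_product, mem_range,
          mem_nestedFinset] at h
        exact Or.inr ⟨G, τ, a, h.2.2, by omega, rfl⟩
  rw [h1, sum_insert, Multiset.card_replicate]
  rw [mem_image]
  rintro ⟨⟨G, a, τ⟩, h, h'⟩
  rw [mem_sigma, mem_product, mem_nestedFinset] at h
  have := congrArg (Multiset.count univ) h'
  rw [Multiset.count_add, h.2.2.count_eq_zero (hP _ h.1), Multiset.count_replicate_self,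
    Multiset.count_replicate_self] at this
  have h2 := mem_range.1 h.2.1
  omega

/-- The generating polynomial of nested multisets with a largest member of size `m`. -/
noncomputable def nestedPoly (m : ℕ) : ℤ[X] :=
  X ^ m + ∑ j : Fin m, (m.choose j : ℤ[X]) * ((∑ a ∈ Ico 1 (m - j), X ^ a) * nestedPoly j)

theorem nestedPoly_eq (m : ℕ) : nestedPoly m = X ^ m + ∑ j ∈ range m,
    (m.choose j : ℤ[X]) * ((∑ a ∈ Ico 1 (m - j), X ^ a) * nestedPoly j) := by
  rw [nestedPoly, sum_range]

theorem sum_card_lt {M : Type*} [AddCommMonoid M] {d : ℕ} {T : Finset α} (hd : d ≤ T.card)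
    (f : ℕ → M) :
    ∑ G ∈ T.powerset with G.card < d, f G.card = ∑ m ∈ range d, T.card.choose m • f m := by
  rw [sum_filter, sum_powerset_apply_card (fun m => if m < d then f m else 0)]
  rw [← sum_subset (range_subset_range.2 (by omega : d ≤ T.card + 1))]
  · exact sum_congr rfl fun m hm => by rw [if_pos (mem_range.1 hm)]
  · intro m _ hm
    rw [if_neg (by simpa using hm), smul_zero]

theorem sum_ssubsets_apply_card {M : Type*} [AddCommMonoid M] (G : Finset α) (f : ℕ → M) :
    ∑ G' ∈ G.ssubsets, f G'.card = ∑ j ∈ range G.card, G.card.choose j • f j := by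
  rw [← sum_card_lt le_rfl]
  refine sum_congr ?_ fun _ _ => rfl
  ext G'
  rw [mem_ssubsets, mem_filter, mem_powerset]
  exact ⟨fun h => ⟨h.1, card_lt_card h⟩, fun h => h.1.ssubset_of_ne fun e => by
    rw [e] at h; exact h.2.false⟩

theorem sum_nestedFinset_eq_nestedPoly (G : Finset α) :
    ∑ τ ∈ nestedFinset G, (X : ℤ[X]) ^ τ.card = nestedPoly G.card := by
  induction G using Finset.strongInduction with
  | H G ih =>
  rw [sum_nestedFinset, nestedPoly_eq,
    sum_congr rfl fun G' hG' => by rw [ih G' (mem_ssubsets.1 hG')],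
    sum_ssubsets_apply_card G fun j => (∑ a ∈ Ico 1 (G.card - j), X ^ a) * nestedPoly j]
  simp only [nsmul_eq_mul]

/-- The Hilbert series of the augmented Chow ring of the uniform matroid of rank `d` on `n`
elements. -/
noncomputable def uniformChowPoly (n d : ℕ) : ℤ[X] :=
  X ^ d + ∑ m ∈ range d, (n.choose m : ℤ[X]) * ((∑ a ∈ range (d - m), X ^ a) * nestedPoly m)

theorem sum_standardFinset_eq {d : ℕ} (hd : d ≤ Fintype.card α) :
    ∑ τ ∈ standardFinset α d, (X : ℤ[X]) ^ τ.card = uniformChowPoly (Fintype.card α) d := by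
  rw [sum_standardFinset hd, uniformChowPoly]
  simp only [sum_nestedFinset_eq_nestedPoly]
  rw [← powerset_univ, sum_card_lt (by rwa [card_univ])
    fun m => (∑ a ∈ range (d - m), X ^ a) * nestedPoly m, card_univ]
  simp only [nsmul_eq_mul]

theorem coeff_uniformChowPoly {d : ℕ} (hd : d ≤ Fintype.card α) (k : ℕ) :
    (uniformChowPoly (Fintype.card α) d).coeff k =
      Nat.card {τ : Multiset (Finset α) // IsStandard d τ ∧ τ.card = k} := by
  rw [← sum_standardFinset_eq hd, finsetSum_coeff]
  simp only [coeff_X_pow]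
  rw [← Finset.sum_filter, Finset.sum_const, nsmul_eq_mul, mul_one,
    Nat.subtype_card ((standardFinset α d).filter fun τ => k = τ.card)]
  intro τ
  rw [mem_filter, mem_standardFinset, eq_comm (a := k)]

theorem augmentedChowSeries_uniformMatroid {d n : ℕ} (hd : d ≤ n) :
    (Matroid.uniformMatroid d n).augmentedChowSeries = (uniformChowPoly n d : PowerSeries ℤ) := by
  ext k
  rw [Matroid.augmentedChowSeries, PowerSeries.coeff_mk, coeff_coe,
    finrank_augmentedChowPiece hd]
  have := coeff_uniformChowPoly (α := Fin n) (d := d) (by simpa using hd) k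
  rw [Fintype.card_fin] at this
  exact this.symm

end Counting

/-! ### Recursions for the Hilbert series and their binomial transform -/

section Identity

open Polynomial

theorem uniformChowPoly_zero (n : ℕ) : uniformChowPoly n 0 = 1 := by
  simp [uniformChowPoly]

/-- Each geometric sum, multiplied by `X`, lacks only the constant term of the next one; the sums of
these constant terms give the correction. -/
theorem uniformChowPoly_succ (n d : ℕ) :
    uniformChowPoly n (d + 1) = X * uniformChowPoly n d +
      ∑ m ∈ range (d + 1), (n.choose m : ℤ[X]) * nestedPoly m := by
  rw [uniformChowPoly, uniformChowPoly, mul_add, ← pow_succ', add_assoc, sum_range_succ,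
    sum_range_succ, mul_sum, ← add_assoc (∑ i ∈ range d, _), ← sum_add_distrib]
  congr 2
  · refine sum_congr rfl fun m hm => ?_
    have := mem_range.1 hm
    rw [show d + 1 - m = d - m + 1 by omega, sum_range_succ']
    simp only [pow_succ', ← mul_sum, pow_zero]
    ring
  · simp

/-- The recursion for `nestedPoly d` supplies X^d and the terms with a ≥ 1, the other summands the
terms with a = 0. -/
theorem uniformChowPoly_self (d : ℕ) :
    uniformChowPoly d d = ∑ m ∈ range (d + 1), (d.choose m : ℤ[X]) * nestedPoly m := by
  rw [sum_range_succ, nestedPoly_eq d, Nat.choose_self, Nat.cast_one, one_mul, uniformChowPoly,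
    add_left_comm, ← sum_add_distrib]
  congr 1
  refine sum_congr rfl fun m hm => ?_
  have := mem_range.1 hm
  rw [range_eq_Ico, sum_eq_sum_Ico_succ_bot (by omega)]
  simp only [pow_zero, zero_add]
  ring

theorem sum_choose_sub (N D : ℕ) (h : D ≤ N) :
    ∑ j ∈ range (D + 1), (N - j).choose (D - j) = (N + 1).choose D := by
  induction D generalizing N with
  | zero => simp
  | succ D ih =>
    obtain ⟨N, rfl⟩ : ∃ N', N = N' + 1 := ⟨N - 1, by omega⟩
    rw [sum_range_succ']
    simp only [Nat.add_sub_add_right, Nat.sub_zero]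
    rw [ih N (by omega), ← Nat.choose_succ_succ]

/-- The binomial transform of the Hilbert series. -/
noncomputable def chowTransform (n d : ℕ) : ℤ[X] :=
  ∑ i ∈ range (d + 1), ((n - i - 1).choose (d - i) : ℤ[X]) * uniformChowPoly n i

theorem chowTransform_self (n : ℕ) : chowTransform n n = uniformChowPoly n n := by
  rw [chowTransform, sum_range_succ, sum_eq_zero, zero_add]
  · simp
  · intro i hi
    have := mem_range.1 hi
    rw [Nat.choose_eq_zero_of_lt (by omega), Nat.cast_zero, zero_mul]

/-- After exchanging the sums, the inner one is a hockey-stick sum equal to C(n-m, d-m), and C(n,m)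
C(n-m,d-m) = C(n,d) C(d,m). -/
theorem sum_choose_mul_partial_sum {n d : ℕ} (h : d < n) (K : ℕ → ℤ[X]) :
    ∑ i ∈ range (d + 1), ((n - i - 1).choose (d - i) : ℤ[X]) *
        ∑ m ∈ range (i + 1), (n.choose m : ℤ[X]) * K m =
      (n.choose d : ℤ[X]) * ∑ m ∈ range (d + 1), (d.choose m : ℤ[X]) * K m := by
  simp only [mul_sum]
  rw [sum_comm' (t' := range (d + 1)) (s' := fun m => Ico m (d + 1))]
  swap
  · intro i m; simp only [mem_range, mem_Ico]; omega
  refine sum_congr rfl fun m hm => ?_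
  have hm' := mem_range.1 hm
  rw [← sum_mul, sum_Ico_eq_sum_range, ← mul_assoc, ← mul_assoc]
  congr 1
  have h1 := sum_choose_sub (n - m - 1) (d - m) (by omega)
  rw [show n - m - 1 + 1 = n - m by omega] at h1
  have h2 := Nat.choose_mul (n := n) (k := d) (s := m) (by omega)
  have h3 : ∑ i ∈ range (d + 1 - m), (n - (m + i) - 1).choose (d - (m + i)) =
      (n - m).choose (d - m) := by
    rw [← h1, show d + 1 - m = d - m + 1 by omega]
    refine sum_congr rfl fun i _ => ?_
    rw [show n - (m + i) - 1 = n - m - 1 - i by omega, Nat.sub_add_eq]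
  rw [← Nat.cast_sum, h3, ← Nat.cast_mul, ← Nat.cast_mul, h2, mul_comm]

/-- By Pascal's rule, adding the transforms for `d + 1` and `d` turns the coefficients into C(n-i,
d+1-i). These are the old coefficients shifted by one in `i`, so the recursion for the Hilbert
series applies to all terms but i = 0. -/
theorem chowTransform_succ {n d : ℕ} (h : d < n) :
    chowTransform n (d + 1) = (X - 1) * chowTransform n d + (n.choose (d + 1) : ℤ[X]) +
      (n.choose d : ℤ[X]) * uniformChowPoly d d := by
  have h1 : chowTransform n (d + 1) + chowTransform n d =
      ∑ i ∈ range (d + 2), ((n - i).choose (d + 1 - i) : ℤ[X]) * uniformChowPoly n i := by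
    rw [chowTransform, chowTransform, sum_range_succ, sum_range_succ _ (d + 1), add_right_comm,
      ← sum_add_distrib]
    congr 1
    · refine sum_congr rfl fun i hi => ?_
      have := mem_range.1 hi
      rw [show n - i = n - i - 1 + 1 by omega, show d + 1 - i = d - i + 1 by omega,
        Nat.choose_succ_succ, Nat.add_sub_cancel]
      push_cast
      ring
    · simp
  rw [sum_range_succ'] at h1
  have h2 := sum_choose_mul_partial_sum h nestedPoly
  rw [← uniformChowPoly_self] at h2
  rw [← h2]
  have h3 : ∀ i ∈ range (d + 1), ((n - (i + 1)).choose (d + 1 - (i + 1)) : ℤ[X]) *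
      uniformChowPoly n (i + 1) = X * (((n - i - 1).choose (d - i) : ℤ[X]) * uniformChowPoly n i) +
        ((n - i - 1).choose (d - i) : ℤ[X]) *
          ∑ m ∈ range (i + 1), (n.choose m : ℤ[X]) * nestedPoly m := by
    intro i _
    rw [uniformChowPoly_succ, Nat.sub_add_eq, Nat.add_sub_add_right]
    ring
  rw [sum_congr rfl h3, sum_add_distrib, ← mul_sum, uniformChowPoly_zero, mul_one, Nat.sub_zero,
    Nat.sub_zero] at h1
  have h4 : chowTransform n d = ∑ i ∈ range (d + 1),
    ((n - i - 1).choose (d - i) : ℤ[X]) * uniformChowPoly n i := rfl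
  rw [← h4] at h1
  linear_combination h1

/-- The binomial transform of the Hilbert series in terms of the Boolean ones. -/
theorem chowTransform_eq {n d : ℕ} (h : d ≤ n) :
    chowTransform n d = ∑ s ∈ range (d + 1), (n.choose s : ℤ[X]) * (X - 1) ^ (d - s) +
      ∑ m ∈ range d, (n.choose m : ℤ[X]) * ((X - 1) ^ (d - m - 1) * uniformChowPoly m m) := by
  induction d with
  | zero => simp [chowTransform, uniformChowPoly_zero]
  | succ d ih =>
    rw [chowTransform_succ (by omega), ih (by omega), mul_add, mul_sum, mul_sum]
    have h1 : ∀ s ∈ range (d + 1), (n.choose s : ℤ[X]) * (X - 1) ^ (d + 1 - s) =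
        (X - 1) * ((n.choose s : ℤ[X]) * (X - 1) ^ (d - s)) := by
      intro s hs
      have := mem_range.1 hs
      rw [show d + 1 - s = d - s + 1 by omega, pow_succ]; ring
    have h2 : ∀ m ∈ range d,
        (n.choose m : ℤ[X]) * ((X - 1) ^ (d + 1 - m - 1) * uniformChowPoly m m) =
        (X - 1) * ((n.choose m : ℤ[X]) * ((X - 1) ^ (d - m - 1) * uniformChowPoly m m)) := by
      intro m hm
      have := mem_range.1 hm
      rw [show d + 1 - m - 1 = d - m - 1 + 1 by omega, pow_succ]; ring
    rw [sum_range_succ (fun s => (n.choose s : ℤ[X]) * (X - 1) ^ (d + 1 - s)), sum_congr rfl h1,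
      sum_range_succ
        (fun m => (n.choose m : ℤ[X]) * ((X - 1) ^ (d + 1 - m - 1) * uniformChowPoly m m)),
      sum_congr rfl h2, Nat.sub_self, pow_zero, show d + 1 - d - 1 = 0 by omega, pow_zero]
    ring

end Identity

/-! ### Faces as pairs of a set and a chain, sorted by the largest flat -/

section Flags

open Polynomial

variable {α : Type*} [DecidableEq α] [Fintype α]

/-- The pairs of a subset `S` of `T` with at most `d` elements and a chain of subsets of `T` with
less than `d` elements, all of which contain `S`. -/
def flagFaces (T : Finset α) (d : ℕ) : Finset (Finset α × Finset (Finset α)) :=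
  univ.filter fun p => p.1 ⊆ T ∧ p.1.card ≤ d ∧
    (∀ F ∈ p.2, F ⊆ T ∧ F.card < d ∧ p.1 ⊆ F) ∧ ∀ F ∈ p.2, ∀ G ∈ p.2, F ⊆ G ∨ G ⊆ F

theorem mem_flagFaces {T : Finset α} {d : ℕ} {p : Finset α × Finset (Finset α)} :
    p ∈ flagFaces T d ↔ p.1 ⊆ T ∧ p.1.card ≤ d ∧
      (∀ F ∈ p.2, F ⊆ T ∧ F.card < d ∧ p.1 ⊆ F) ∧ ∀ F ∈ p.2, ∀ G ∈ p.2, F ⊆ G ∨ G ⊆ F := by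
  simp [flagFaces]

/-- The members of the chain have distinct sizes in the interval from |S| to d - 1. -/
theorem card_add_card_le_of_mem_flagFaces {T : Finset α} {d : ℕ}
    {p : Finset α × Finset (Finset α)} (hp : p ∈ flagFaces T d) :
    p.1.card + p.2.card ≤ d := by
  obtain ⟨-, h1, h2, h3⟩ := mem_flagFaces.1 hp
  have h4 : p.2.card ≤ (Ico p.1.card d).card := by
    refine card_le_card_of_injOn card (fun F hF => ?_) fun F hF G hG h => ?_
    · exact mem_coe.2 (mem_Ico.2 ⟨card_le_card (h2 F hF).2.2, (h2 F hF).2.1⟩)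
    · rcases h3 F hF G hG with h' | h'
      · exact eq_of_subset_of_card_le h' h.ge
      · exact (eq_of_subset_of_card_le h' h.le).symm
  rw [Nat.card_Ico] at h4
  omega

/-- The generating polynomial of `flagFaces`. -/
noncomputable def flagPoly (T : Finset α) (d : ℕ) : ℤ[X] :=
  ∑ p ∈ flagFaces T d, (X - 1) ^ (d - (p.1.card + p.2.card))

theorem sup_id_mem_of_chain {c : Finset (Finset α)} (h0 : c.Nonempty)
    (hc : ∀ A ∈ c, ∀ B ∈ c, A ⊆ B ∨ B ⊆ A) : c.sup id ∈ c := by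
  obtain ⟨G, hG, hmax⟩ := exists_max_image c card h0
  have : c.sup id = G := by
    refine le_antisymm (Finset.sup_le fun A hA => ?_) (le_sup (f := id) hG)
    rcases hc A hA G hG with h | h
    · exact h
    · exact (eq_of_subset_of_card_le h (hmax A hA)).ge
  rwa [this]

/-- Removing the largest flat `G` leaves a set and a chain of proper subsets of `G`, a face for the
Boolean matroid on `G`. The exponent splits as (d - |G| - 1) plus the exponent of the remaining face
in rank |G|. -/
theorem sum_flagFaces_nonempty (T : Finset α) (d : ℕ) :
    ∑ p ∈ flagFaces T d with p.2.Nonempty, (X - 1 : ℤ[X]) ^ (d - (p.1.card + p.2.card)) =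
      ∑ G ∈ T.powerset with G.card < d, (X - 1) ^ (d - G.card - 1) * flagPoly G G.card := by
  simp only [flagPoly, mul_sum]
  rw [sum_sigma']
  refine sum_bij' (fun p _ => ⟨p.2.sup id, p.1, p.2.erase (p.2.sup id)⟩)
    (fun q _ => (q.2.1, insert q.1 q.2.2)) ?_ ?_ ?_ ?_ ?_
  · rintro ⟨S, c⟩ hp
    rw [mem_filter, mem_flagFaces] at hp
    obtain ⟨⟨h1, h2, h3, h4⟩, h5⟩ := hp
    dsimp only at h1 h2 h3 h4 h5 ⊢
    have hm := sup_id_mem_of_chain h5 h4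
    obtain ⟨k1, k2, k3⟩ := h3 _ hm
    rw [mem_sigma, mem_filter, mem_powerset, mem_flagFaces]
    refine ⟨⟨k1, k2⟩, k3, card_le_card k3, fun F hF => ?_, fun F hF G hG =>
      h4 F (mem_of_mem_erase hF) G (mem_of_mem_erase hG)⟩
    have hF' : F ⊆ c.sup id := le_sup (f := id) (mem_of_mem_erase hF)
    exact ⟨hF', card_lt_card (hF'.ssubset_of_ne (ne_of_mem_erase hF)),
      (h3 F (mem_of_mem_erase hF)).2.2⟩
  · rintro ⟨G, S, c⟩ hq
    rw [mem_sigma, mem_filter, mem_powerset, mem_flagFaces] at hq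
    obtain ⟨⟨hGT, hGd⟩, h1, h2, h3, h4⟩ := hq
    dsimp only at hGT hGd h1 h2 h3 h4 ⊢
    rw [mem_filter, mem_flagFaces]
    refine ⟨⟨h1.trans hGT, h2.trans hGd.le, ?_, ?_⟩, insert_nonempty _ _⟩
    · intro F hF
      rcases mem_insert.1 hF with rfl | hF
      · exact ⟨hGT, hGd, h1⟩
      · exact ⟨(h3 F hF).1.trans hGT, (h3 F hF).2.1.trans hGd, (h3 F hF).2.2⟩
    · intro F hF F' hF'
      rcases mem_insert.1 hF with e | k <;> rcases mem_insert.1 hF' with e' | k'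
      · rw [e, e']; exact Or.inl subset_rfl
      · rw [e]; exact Or.inr (h3 F' k').1
      · rw [e']; exact Or.inl (h3 F k).1
      · exact h4 F k F' k'
  · rintro ⟨S, c⟩ hp
    rw [mem_filter, mem_flagFaces] at hp
    dsimp only
    rw [insert_erase (sup_id_mem_of_chain hp.2 hp.1.2.2.2)]
  · rintro ⟨G, S, c⟩ hq
    rw [mem_sigma, mem_filter, mem_powerset, mem_flagFaces] at hq
    obtain ⟨-, h1, h2, h3, h4⟩ := hq
    dsimp only at h1 h2 h3 h4 ⊢
    have hs : (insert G c).sup id = G := by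
      rw [sup_insert, id, sup_eq_left]
      exact Finset.sup_le fun F hF => (h3 F hF).1
    have hG : G ∉ c := fun h => (h3 G h).2.1.false
    rw [hs, erase_insert hG]
  · rintro ⟨S, c⟩ hp
    rw [mem_filter] at hp
    obtain ⟨hp1, h5⟩ := hp
    have hle := card_add_card_le_of_mem_flagFaces hp1
    obtain ⟨h1, h2, h3, h4⟩ := mem_flagFaces.1 hp1
    dsimp only at *
    have hm := sup_id_mem_of_chain h5 h4
    have hlt := (h3 _ hm).2.1
    have hle' : S.card + (c.erase (c.sup id)).card ≤ (c.sup id).card := by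
      refine card_add_card_le_of_mem_flagFaces (T := c.sup id) (p := (S, c.erase (c.sup id))) ?_
      rw [mem_flagFaces]
      refine ⟨(h3 _ hm).2.2, card_le_card (h3 _ hm).2.2, fun F hF => ?_, fun F hF G hG =>
        h4 F (mem_of_mem_erase hF) G (mem_of_mem_erase hG)⟩
      have hF' : F ⊆ c.sup id := le_sup (f := id) (mem_of_mem_erase hF)
      exact ⟨hF', card_lt_card (hF'.ssubset_of_ne (ne_of_mem_erase hF)),
        (h3 F (mem_of_mem_erase hF)).2.2⟩
    have hc := card_erase_add_one hm
    rw [← pow_add]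
    congr 1
    omega

theorem sum_flagFaces_empty {T : Finset α} {d : ℕ} (hd : d ≤ T.card) :
    ∑ p ∈ flagFaces T d with ¬ p.2.Nonempty, (X - 1 : ℤ[X]) ^ (d - (p.1.card + p.2.card)) =
      ∑ s ∈ range (d + 1), (T.card.choose s : ℤ[X]) * (X - 1) ^ (d - s) := by
  have h1 : ∑ p ∈ flagFaces T d with ¬ p.2.Nonempty,
      (X - 1 : ℤ[X]) ^ (d - (p.1.card + p.2.card)) =
      ∑ S ∈ T.powerset, if S.card ≤ d then (X - 1 : ℤ[X]) ^ (d - S.card) else 0 := by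
    rw [← sum_filter]
    refine sum_bij' (fun p _ => p.1) (fun S _ => (S, ∅)) ?_ ?_ ?_ ?_ ?_
    · intro p hp
      rw [mem_filter, mem_flagFaces] at hp
      exact mem_filter.2 ⟨mem_powerset.2 hp.1.1, hp.1.2.1⟩
    · intro S hS
      rw [mem_filter, mem_powerset] at hS
      rw [mem_filter, mem_flagFaces]
      exact ⟨⟨hS.1, hS.2, by simp, by simp⟩, by simp⟩
    · rintro ⟨S, c⟩ hp
      rw [mem_filter, not_nonempty_iff_eq_empty] at hp
      exact Prod.ext rfl hp.2.symm
    · intro S _; rfl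
    · rintro ⟨S, c⟩ hp
      rw [mem_filter, not_nonempty_iff_eq_empty] at hp
      rw [hp.2, card_empty, add_zero]
  rw [h1, sum_powerset_apply_card (fun s => if s ≤ d then (X - 1 : ℤ[X]) ^ (d - s) else 0),
    ← sum_subset (range_subset_range.2 (by omega : d + 1 ≤ T.card + 1))]
  · refine sum_congr rfl fun s hs => ?_
    have := mem_range.1 hs
    rw [if_pos (by omega), nsmul_eq_mul]
  · intro s _ hs
    rw [mem_range] at hs
    rw [if_neg (by omega), smul_zero]

/-- Both sides split into a part without flats and a sum over G; for the latter, induction applies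
in rank |G| < d, where the transform on the diagonal is the Hilbert series itself. -/
theorem flagPoly_eq_chowTransform {T : Finset α} {d : ℕ} (hd : d ≤ T.card) :
    flagPoly T d = chowTransform T.card d := by
  induction d using Nat.strong_induction_on generalizing T with
  | _ d ih =>
  rw [flagPoly, ← sum_filter_add_sum_filter_not _ (fun p => p.2.Nonempty), sum_flagFaces_empty hd,
    sum_flagFaces_nonempty, chowTransform_eq hd, add_comm]
  congr 1
  have h1 : ∀ G ∈ T.powerset.filter (fun G => G.card < d),
      (X - 1 : ℤ[X]) ^ (d - G.card - 1) * flagPoly G G.card =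
        (X - 1) ^ (d - G.card - 1) * uniformChowPoly G.card G.card := by
    intro G hG
    rw [ih G.card (mem_filter.1 hG).2 le_rfl, chowTransform_self]
  rw [sum_congr rfl h1, sum_card_lt hd
    (fun m => (X - 1 : ℤ[X]) ^ (d - m - 1) * uniformChowPoly m m)]
  simp only [nsmul_eq_mul]

end Flags

/-! ### The augmented Bergman complex and its h-polynomial -/

section Bergman

open Matroid

variable {d n : ℕ}

/-- The pair of a set and a chain of sets given by a set of vertices of the augmented Bergman
complex. -/
noncomputable def flagOfFace (σ : Finset (uniformMatroid d n).AugVertex) :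
    Finset (Fin n) × Finset (Finset (Fin n)) :=
  (σ.toLeft.image fun i => i.1, σ.toRight.image finsetOfFlat)

theorem card_flagOfFace (σ : Finset (uniformMatroid d n).AugVertex) :
    (flagOfFace σ).1.card + (flagOfFace σ).2.card = σ.card := by
  rw [flagOfFace, card_image_of_injective _ Subtype.val_injective,
    card_image_of_injective _ finsetOfFlat_injective, card_toLeft_add_card_toRight]

theorem flagOfFace_injective :
    Function.Injective (flagOfFace : Finset (uniformMatroid d n).AugVertex → _) := by
  intro σ τ h
  rw [flagOfFace, flagOfFace, Prod.mk.injEq] at h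
  have h1 := image_injective Subtype.val_injective h.1
  have h2 := image_injective finsetOfFlat_injective h.2
  rw [← toLeft_disjSum_toRight (u := σ), h1, h2, toLeft_disjSum_toRight]

theorem isAugFace_iff_flagOfFace_mem (hd : d ≤ n) (σ : Finset (uniformMatroid d n).AugVertex) :
    (uniformMatroid d n).IsAugFace σ ↔ flagOfFace σ ∈ flagFaces univ d := by
  have h0 : {a : Fin n | ∃ i : (uniformMatroid d n).E, (i : Fin n) = a ∧ Sum.inl i ∈ σ} =
      ((flagOfFace σ).1 : Set (Fin n)) := by
    ext a
    simp only [flagOfFace, Set.mem_ofPred_eq, coe_image, Set.mem_image, mem_coe, mem_toLeft]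
    exact ⟨fun ⟨i, h1, h2⟩ => ⟨i, h2, h1⟩, fun ⟨i, h2, h1⟩ => ⟨i, h1, h2⟩⟩
  rw [IsAugFace, h0, uniformMatroid_indep_iff, Set.ncard_coe_finset, mem_flagFaces]
  have hsub : ∀ F G : (uniformMatroid d n).ProperFlat,
      finsetOfFlat F ⊆ finsetOfFlat G ↔ F.1 ⊆ G.1 := by
    intro F G
    rw [← coe_subset, coe_finsetOfFlat, coe_finsetOfFlat]
  have hmem : ∀ (i : Fin n) (F : (uniformMatroid d n).ProperFlat),
      i ∈ finsetOfFlat F ↔ i ∈ F.1 := by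
    intro i F
    rw [← mem_coe, coe_finsetOfFlat]
  constructor
  · rintro ⟨h1, h2, h3⟩
    refine ⟨subset_univ _, h1, ?_, ?_⟩
    · intro F hF
      obtain ⟨F, kF, rfl⟩ := mem_image.1 hF
      refine ⟨subset_univ _, card_finsetOfFlat hd F, fun i hi => ?_⟩
      obtain ⟨i, ki, rfl⟩ := mem_image.1 hi
      exact (hmem _ _).2 (h3 i F (mem_toLeft.1 ki) (mem_toRight.1 kF))
    · intro F hF G hG
      obtain ⟨F, kF, rfl⟩ := mem_image.1 hF
      obtain ⟨G, kG, rfl⟩ := mem_image.1 hG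
      rw [hsub, hsub]
      exact h2 F G (mem_toRight.1 kF) (mem_toRight.1 kG)
  · rintro ⟨-, h1, h2, h3⟩
    have hF' : ∀ F, Sum.inr F ∈ σ → finsetOfFlat F ∈ (flagOfFace σ).2 := fun F hF =>
      mem_image_of_mem _ (mem_toRight.2 hF)
    refine ⟨h1, fun F G hF hG => ?_, fun i F hi hF => ?_⟩
    · rw [← hsub, ← hsub]
      exact h3 _ (hF' F hF) _ (hF' G hG)
    · rw [← hmem]
      exact (h2 _ (hF' F hF)).2.2 (mem_image_of_mem _ (mem_toLeft.2 hi))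

theorem mem_faces_augmentedBergmanComplex {σ : Finset (uniformMatroid d n).AugVertex} :
    σ ∈ (uniformMatroid d n).augmentedBergmanComplex.faces ↔
      (uniformMatroid d n).IsAugFace σ := by
  simp [augmentedBergmanComplex]

theorem exists_flagOfFace_eq (hd : d ≤ n) {p : Finset (Fin n) × Finset (Finset (Fin n))}
    (hp : p ∈ flagFaces univ d) : ∃ σ : Finset (uniformMatroid d n).AugVertex,
      flagOfFace σ = p := by
  classical
  obtain ⟨S, c⟩ := p
  refine ⟨(S.image fun i => (⟨i, Set.mem_univ i⟩ : (uniformMatroid d n).E)).disjSum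
    (c.attach.image fun F => flatOfFinset hd F.1 ((mem_flagFaces.1 hp).2.2.1 F.1 F.2).2.1), ?_⟩
  rw [flagOfFace, toLeft_disjSum, toRight_disjSum, image_image, image_image]
  refine Prod.ext ?_ ?_
  · exact image_id
  · ext F
    simp only [mem_image, mem_attach, true_and, Function.comp_apply, finsetOfFlat_flatOfFinset]
    exact ⟨fun ⟨G, hG⟩ => hG ▸ G.2, fun hF => ⟨⟨F, hF⟩, rfl⟩⟩

theorem sum_faces_eq_sum_flagFaces (hd : d ≤ n) {M : Type*} [AddCommMonoid M] (f : ℕ → M) :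
    ∑ σ ∈ (uniformMatroid d n).augmentedBergmanComplex.faces, f σ.card =
      ∑ p ∈ flagFaces (univ : Finset (Fin n)) d, f (p.1.card + p.2.card) := by
  refine sum_bij (fun σ _ => flagOfFace σ) ?_ ?_ ?_ ?_
  · intro σ hσ
    exact (isAugFace_iff_flagOfFace_mem hd σ).1 (mem_faces_augmentedBergmanComplex.1 hσ)
  · intro σ _ τ _ h
    exact flagOfFace_injective h
  · intro p hp
    obtain ⟨σ, rfl⟩ := exists_flagOfFace_eq hd hp
    exact ⟨σ, mem_faces_augmentedBergmanComplex.2 ((isAugFace_iff_flagOfFace_mem hd σ).2 hp), rfl⟩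
  · intro σ _
    rw [card_flagOfFace]

theorem card_le_of_mem_faces (hd : d ≤ n) {σ : Finset (uniformMatroid d n).AugVertex}
    (hσ : σ ∈ (uniformMatroid d n).augmentedBergmanComplex.faces) : σ.card ≤ d := by
  rw [← card_flagOfFace]
  exact card_add_card_le_of_mem_flagFaces
    ((isAugFace_iff_flagOfFace_mem hd σ).1 (mem_faces_augmentedBergmanComplex.1 hσ))

theorem maxCard_augmentedBergmanComplex (hd : d ≤ n) :
    (uniformMatroid d n).augmentedBergmanComplex.maxCard = d := by
  refine le_antisymm (Finset.sup_le fun σ hσ => card_le_of_mem_faces hd hσ) ?_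
  obtain ⟨S, -, hS⟩ := exists_subset_card_eq (s := (univ : Finset (Fin n))) (n := d)
    (by simpa using hd)
  have hp : ((S, ∅) : Finset (Fin n) × Finset (Finset (Fin n))) ∈ flagFaces univ d := by
    rw [mem_flagFaces]
    exact ⟨subset_univ _, hS.le, by simp, by simp⟩
  obtain ⟨σ, hσ⟩ := exists_flagOfFace_eq hd hp
  have hc := card_flagOfFace σ
  rw [hσ, hS, card_empty, add_zero] at hc
  rw [FinSimplicialComplex.maxCard]
  calc d = σ.card := hc
    _ ≤ _ := le_sup (f := card) (mem_faces_augmentedBergmanComplex.2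
      ((isAugFace_iff_flagOfFace_mem hd σ).2 (hσ ▸ hp)))

theorem single_mul_aeval_hPolynomial (hd : d ≤ n) :
    (HahnSeries.single (d : ℤ) (1 : ℤ) : LaurentSeries ℤ) *
        Polynomial.aeval (HahnSeries.single (-1 : ℤ) (1 : ℤ) : LaurentSeries ℤ)
          (uniformMatroid d n).augmentedBergmanComplex.hPolynomial =
      HahnSeries.ofPowerSeries ℤ ℤ (chowTransform n d : PowerSeries ℤ) := by
  have hinv : (HahnSeries.single (1 : ℤ) (1 : ℤ) : LaurentSeries ℤ) *
      HahnSeries.single (-1 : ℤ) (1 : ℤ) = 1 := by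
    rw [HahnSeries.single_mul_single]; simp
  have hX : HahnSeries.ofPowerSeries ℤ ℤ PowerSeries.X =
      (HahnSeries.single (1 : ℤ) (1 : ℤ) : LaurentSeries ℤ) := HahnSeries.ofPowerSeries_X
  have hpow : (HahnSeries.single (d : ℤ) (1 : ℤ) : LaurentSeries ℤ) =
      HahnSeries.single (1 : ℤ) (1 : ℤ) ^ d := by
    rw [HahnSeries.single_pow]; simp
  have hflag := flagPoly_eq_chowTransform (T := (univ : Finset (Fin n))) (d := d)
    (by simpa using hd)
  rw [card_univ, Fintype.card_fin, flagPoly,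
    ← sum_faces_eq_sum_flagFaces hd fun m => (Polynomial.X - 1 : Polynomial ℤ) ^ (d - m)] at hflag
  rw [← hflag, FinSimplicialComplex.hPolynomial, maxCard_augmentedBergmanComplex hd, map_sum,
    mul_sum, ← Polynomial.coeToPowerSeries.ringHom_apply, map_sum, map_sum]
  refine sum_congr rfl fun σ hσ => ?_
  have hc := card_le_of_mem_faces hd hσ
  have hr : HahnSeries.ofPowerSeries ℤ ℤ (Polynomial.coeToPowerSeries.ringHom
      ((Polynomial.X - 1 : Polynomial ℤ) ^ (d - σ.card))) =
      (HahnSeries.single (1 : ℤ) (1 : ℤ) - 1 : LaurentSeries ℤ) ^ (d - σ.card) := by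
    rw [map_pow, map_pow, map_sub, map_sub, RingHom.map_one, RingHom.map_one,
      Polynomial.coeToPowerSeries.ringHom_apply, Polynomial.coe_X, hX]
  have hl : ∀ z : LaurentSeries ℤ, Polynomial.aeval z (Polynomial.X ^ σ.card *
      (1 - Polynomial.X : Polynomial ℤ) ^ (d - σ.card)) = z ^ σ.card * (1 - z) ^ (d - σ.card) := by
    intro z; simp
  rw [hr, hl, hpow]
  -- From here on only x z = 1 is used: x^d z^s (1 - z)^(d-s) = (x - 1)^(d-s).
  generalize (HahnSeries.single (1 : ℤ) (1 : ℤ) : LaurentSeries ℤ) = x at *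
  generalize (HahnSeries.single (-1 : ℤ) (1 : ℤ) : LaurentSeries ℤ) = z at *
  obtain ⟨e, he⟩ := Nat.exists_eq_add_of_le hc
  have hx : x ^ d = x ^ σ.card * x ^ e := (congrArg (x ^ ·) he).trans (pow_add x _ _)
  rw [show d - σ.card = e by omega, hx]
  calc x ^ σ.card * x ^ e * (z ^ σ.card * (1 - z) ^ e)
      = (x * z) ^ σ.card * (x - x * z) ^ e := by rw [mul_pow, ← mul_one_sub, mul_pow]; ring
    _ = (x - 1) ^ e := by rw [hinv, one_pow, one_mul]

end Bergman

/-- The identity `x^d h(Δ_{U_{d,n}}, 1/x) = ∑_{i=0}^d C(n-i-1, d-i) H_{U_{i,n}}(x)` of formal Laurent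
series in `x`, where `HahnSeries.single m 1` is `x^m`. The truncated subtraction `n - i - 1` differs
from the integer one only for `i = d = n`, where `C(-1, 0) = 1 = C(0, 0)`. -/
theorem mainTheorem4 (d n : ℕ) (hdn : d ≤ n) :
    (HahnSeries.single (d : ℤ) (1 : ℤ) : LaurentSeries ℤ) *
        Polynomial.aeval (HahnSeries.single (-1 : ℤ) (1 : ℤ) : LaurentSeries ℤ)
          (Matroid.uniformMatroid d n).augmentedBergmanComplex.hPolynomial =
      ∑ i ∈ Finset.range (d + 1), ((n - i - 1).choose (d - i) : LaurentSeries ℤ) *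
        HahnSeries.ofPowerSeries ℤ ℤ (Matroid.uniformMatroid i n).augmentedChowSeries := by
  rw [single_mul_aeval_hPolynomial hdn, chowTransform,
    ← Polynomial.coeToPowerSeries.ringHom_apply, map_sum, map_sum]
  refine Finset.sum_congr rfl fun i hi => ?_
  have := Finset.mem_range.1 hi
  rw [augmentedChowSeries_uniformMatroid (by omega : i ≤ n), map_mul, map_mul, map_natCast,
    map_natCast, Polynomial.coeToPowerSeries.ringHom_apply]
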